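/- Let $T>0$, let $\Omega\subseteq\mathbb R^d$ be open, $H=L^2(\Omega,dx)$ (real valued), and let $V$ be a closed subspace of $H^1(\Omega)$ containing $H^1_0(\Omega)$, with dual $V'$; view $V\hookrightarrow H\hookrightarrow V'$ via $v\mapsto (v\,|\,\cdot)_{H}$. Let $a_{kj}:[0,T]\times\Omega\to\mathbb R$ ($1\le k,j\le d$) be measurable and uniformly bounded, and suppose that for some constant $\eta>0$ $$\sum_{k,j=1}^d a_{kj}(t,x)\,\xi_k\xi_j\ \ge\ \eta|\xi|^2\qquad\text{for all }\xi\in\mathbb R^d\text{ and a.e. }(t,x)\in[0,T]\times\Omega .$$ For $t\in[0,T]$ put $$\mathfrak a(t,y,v)=\sum_{k,j=1}^d\int_\Omega a_{kj}(t,x)\,\partial_k y\,\partial_j v\,dx\quad (y,v\in V),$$ and let $\mathcal A(t):V\to V'$ be given by $\langle\mathcal A(t)y,v\rangle=\mathfrak a(t,y,v)$. Let $f\in L^2(0,T;V')$, $u_0\in H$, and let $u\in H^1(0,T;V')\cap L^2(0,T;V)$ be the solution of $$\dot u(t)+\mathcal A(t)u(t)=f(t)\ \text{ for a.e. }t\in(0,T),\qquad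 u(0)=u_0,$$ where $u$ is identified with its continuous representative in $C([0,T];H)$. Write $f\ge0$ if for every $v\in V$ with $v\ge0$ a.e. one has $\langle f(t),v\rangle\ge0$ for a.e. $t$, and $f\le 0$ if $-f\ge0$. Inequalities between elements of $H$ are meant almost everywhere on $\Omega$. 1. If $f\ge0$, $v^+=\max\{v,0\}\in V$ for all $v\in V$, and $u_0\ge0$, then $u(t)\ge0$ for all $t\in[0,T]$. 2. If $f\le0$, $v\wedge1=\min\{v,1\}\in V$ for all $v\in V$, and $u_0\le1$, then $u(t)\le1$ for all $t\in[0,T]$. -/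

import Mathlib

open MeasureTheory Set
open TopologicalSpace (Opens)
open scoped Distributions

noncomputable section

namespace NonautForm

variable {d : ℕ}

/-- The real Hilbert space `L²(Ω, dx)`. -/
abbrev L2 (Ω : Opens (EuclideanSpace ℝ (Fin d))) : Type :=
  Lp ℝ 2 (volume.restrict (Ω : Set (EuclideanSpace ℝ (Fin d))))

/-- `g` is the weak partial derivative `∂ₖ u` on `Ω`: for all test functions `φ ∈ C_c^∞(Ω)`,
`∫_Ω u ∂ₖφ = - ∫_Ω g φ`. -/
def HasWeakPartial (Ω : Opens (EuclideanSpace ℝ (Fin d))) (k : Fin d) (u g : L2 Ω) : Prop :=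
  ∀ φ : 𝓓(Ω, ℝ),
    ∫ x in (Ω : Set (EuclideanSpace ℝ (Fin d))),
        u x * fderiv ℝ φ x (EuclideanSpace.single k 1)
      = -∫ x in (Ω : Set (EuclideanSpace ℝ (Fin d))), g x * φ x

theorem integrable_L2_mul {Ω : Opens (EuclideanSpace ℝ (Fin d))} (u : L2 Ω)
    {ψ : EuclideanSpace ℝ (Fin d) → ℝ} (hc : Continuous ψ) (hs : HasCompactSupport ψ) :
    Integrable (fun x => u x * ψ x)
      (volume.restrict (Ω : Set (EuclideanSpace ℝ (Fin d)))) :=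
  (Lp.memLp u).integrable_mul (q := 2) ((hc.memLp_of_hasCompactSupport hs).restrict _)

theorem continuous_fderiv_test {Ω : Opens (EuclideanSpace ℝ (Fin d))} (φ : 𝓓(Ω, ℝ))
    (v : EuclideanSpace ℝ (Fin d)) : Continuous (fun x => fderiv ℝ φ x v) :=
  (φ.contDiff.continuous_fderiv (by simp)).clm_apply continuous_const

theorem hasCompactSupport_fderiv_test {Ω : Opens (EuclideanSpace ℝ (Fin d))} (φ : 𝓓(Ω, ℝ))
    (v : EuclideanSpace ℝ (Fin d)) : HasCompactSupport (fun x => fderiv ℝ φ x v) :=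
  φ.hasCompactSupport.fderiv_apply ℝ v

/-- The Sobolev space `H¹(Ω)`, as the subspace of `L²(Ω) × L²(Ω)^d` of all pairs `(u, ∇u)` with
`u ∈ L²(Ω)` whose weak partial derivatives lie in `L²(Ω)`. -/
def H1Sub (Ω : Opens (EuclideanSpace ℝ (Fin d))) :
    Submodule ℝ (WithLp 2 (L2 Ω × PiLp 2 (fun _ : Fin d => L2 Ω))) where
  carrier := {p | ∀ k, HasWeakPartial Ω k p.fst (p.snd k)}
  zero_mem' := by
    intro k φ
    have h := Lp.coeFn_zero ℝ 2 (volume.restrict (Ω : Set (EuclideanSpace ℝ (Fin d))))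
    have h1 : ∀ ψ : EuclideanSpace ℝ (Fin d) → ℝ,
        ∫ x in (Ω : Set (EuclideanSpace ℝ (Fin d))), (0 : L2 Ω) x * ψ x = 0 := by
      intro ψ
      refine integral_eq_zero_of_ae ?_
      filter_upwards [h] with x hx
      rw [hx, Pi.zero_apply]; exact zero_mul _
    exact (h1 _).trans (neg_eq_zero.mpr (h1 φ)).symm
  add_mem' := by
    intro p q hp hq k φ
    have key : ∀ (u v : L2 Ω) (ψ : EuclideanSpace ℝ (Fin d) → ℝ), Continuous ψ →
        HasCompactSupport ψ →
        ∫ x in (Ω : Set (EuclideanSpace ℝ (Fin d))), (u + v) x * ψ x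
          = (∫ x in (Ω : Set (EuclideanSpace ℝ (Fin d))), u x * ψ x)
            + ∫ x in (Ω : Set (EuclideanSpace ℝ (Fin d))), v x * ψ x := by
      intro u v ψ hc hs
      rw [← integral_add (integrable_L2_mul u hc hs) (integrable_L2_mul v hc hs)]
      refine integral_congr_ae ?_
      filter_upwards [Lp.coeFn_add u v] with x hx
      rw [hx, Pi.add_apply, add_mul]
    have h1 := hp k φ
    have h2 := hq k φ
    simp only [WithLp.add_fst, WithLp.add_snd, PiLp.add_apply]
    rw [key _ _ _ (continuous_fderiv_test φ _) (hasCompactSupport_fderiv_test φ _),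
      key _ _ _ φ.continuous φ.hasCompactSupport, h1, h2]
    ring
  smul_mem' := by
    intro c p hp k φ
    have key : ∀ (u : L2 Ω) (ψ : EuclideanSpace ℝ (Fin d) → ℝ),
        ∫ x in (Ω : Set (EuclideanSpace ℝ (Fin d))), (c • u) x * ψ x
          = c * ∫ x in (Ω : Set (EuclideanSpace ℝ (Fin d))), u x * ψ x := by
      intro u ψ
      rw [← integral_const_mul]
      refine integral_congr_ae ?_
      filter_upwards [Lp.coeFn_smul c u] with x hx
      rw [hx, Pi.smul_apply, smul_eq_mul, mul_assoc]
    have h1 := hp k φ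
    simp only [WithLp.smul_fst, WithLp.smul_snd, PiLp.smul_apply]
    rw [key, key, h1]
    ring

/-- The Sobolev space `H¹(Ω)` with `(u | v) = (u | v)_{L²} + ∑ₖ (∂ₖu | ∂ₖv)_{L²}`. -/
def H1 (Ω : Opens (EuclideanSpace ℝ (Fin d))) : Type := H1Sub Ω

instance (Ω : Opens (EuclideanSpace ℝ (Fin d))) : NormedAddCommGroup (H1 Ω) :=
  inferInstanceAs (NormedAddCommGroup (H1Sub Ω))

instance (Ω : Opens (EuclideanSpace ℝ (Fin d))) : InnerProductSpace ℝ (H1 Ω) :=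
  inferInstanceAs (InnerProductSpace ℝ (H1Sub Ω))

variable {Ω : Opens (EuclideanSpace ℝ (Fin d))}

/-- The embedding `H¹(Ω) → L²(Ω)`, `(u, ∇u) ↦ u`. -/
def toL2 : H1 Ω →L[ℝ] L2 Ω :=
  LinearMap.mkContinuous
    { toFun := fun u => u.1.fst
      map_add' := fun _ _ => rfl
      map_smul' := fun _ _ => rfl } 1
    (fun u => by
      rw [one_mul]
      exact WithLp.norm_fst_le _ u.1)

/-- The weak partial derivative `∂ₖ u ∈ L²(Ω)` of `u ∈ H¹(Ω)`. -/
def partialD (k : Fin d) (u : H1 Ω) : L2 Ω := u.1.snd k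

/-- `H¹₀(Ω)`: the closure of `C_c^∞(Ω)` in `H¹(Ω)`. -/
def H10 (Ω : Opens (EuclideanSpace ℝ (Fin d))) : Submodule ℝ (H1 Ω) :=
  (Submodule.span ℝ {u : H1 Ω | ∃ φ : 𝓓(Ω, ℝ),
    toL2 u =ᵐ[volume.restrict (Ω : Set (EuclideanSpace ℝ (Fin d)))] φ}).topologicalClosure

/-- The dual space `E'` of a real normed space `E`, with the dual norm. -/
abbrev NDual (E : Type*) [NormedAddCommGroup E] [NormedSpace ℝ E] : Type _ := StrongDual ℝ E

/-- The embedding `V → L²(Ω)` of a subspace `V` of `H¹(Ω)`. -/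
def emb (V : Submodule ℝ (H1 Ω)) : V →L[ℝ] L2 Ω := toL2.comp V.subtypeL

/-- The embedding `V → L²(Ω) → V'`, `v ↦ (v | ·)_{L²}`, where `V'` is the dual of `V`. -/
def embDual (V : Submodule ℝ (H1 Ω)) (v : V) : NDual V :=
  (innerSL ℝ (emb V v)).comp (emb V)

/-- `V` is stable under `v ↦ v⁺ = max v 0`. -/
def StablePosPart (V : Submodule ℝ (H1 Ω)) : Prop :=
  ∀ v : V, ∃ w : V, ∀ᵐ x ∂volume.restrict (Ω : Set (EuclideanSpace ℝ (Fin d))),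
    emb V w x = max (emb V v x) 0

/-- `V` is stable under `v ↦ v ∧ 1 = min v 1`. -/
def StableMinOne (V : Submodule ℝ (H1 Ω)) : Prop :=
  ∀ v : V, ∃ w : V, ∀ᵐ x ∂volume.restrict (Ω : Set (EuclideanSpace ℝ (Fin d))),
    emb V w x = min (emb V v x) 1

/-- The coefficients `a k j` are (Lebesgue) measurable and uniformly bounded on `[0,T] × Ω`, and
uniformly elliptic almost everywhere. -/
structure IsEllipticCoeff (T : ℝ) (Ω : Opens (EuclideanSpace ℝ (Fin d)))
    (a : Fin d → Fin d → ℝ → EuclideanSpace ℝ (Fin d) → ℝ) : Prop where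
  measurable : ∀ k j, AEMeasurable (fun p : ℝ × EuclideanSpace ℝ (Fin d) => a k j p.1 p.2)
    (volume.restrict (Icc 0 T ×ˢ (Ω : Set (EuclideanSpace ℝ (Fin d)))))
  bounded : ∃ M : ℝ, ∀ k j, ∀ t ∈ Icc 0 T, ∀ x ∈ Ω, |a k j t x| ≤ M
  elliptic : ∃ η : ℝ, 0 < η ∧
    ∀ᵐ p : ℝ × EuclideanSpace ℝ (Fin d)
        ∂volume.restrict (Icc 0 T ×ˢ (Ω : Set (EuclideanSpace ℝ (Fin d)))),
      ∀ ξ : EuclideanSpace ℝ (Fin d),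
        η * ‖ξ‖ ^ 2 ≤ ∑ k, ∑ j, a k j p.1 p.2 * ξ k * ξ j

/-- The form `𝔞(t,u,v) = ∑_{k,j} ∫_Ω a_{kj}(t,x) ∂ₖu(x) ∂ⱼv(x) dx`. -/
def form (a : Fin d → Fin d → ℝ → EuclideanSpace ℝ (Fin d) → ℝ) (t : ℝ) (u v : H1 Ω) : ℝ :=
  ∑ k, ∑ j, ∫ x in (Ω : Set (EuclideanSpace ℝ (Fin d))),
    a k j t x * partialD k u x * partialD j v x

/-- `g'` is the weak derivative of `g` on `(0,T)`, for functions with values in a Banach space: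
for all `φ ∈ C_c^∞(0,T)`, `∫₀ᵀ φ'(t) g(t) dt = - ∫₀ᵀ φ(t) g'(t) dt`. -/
def HasWeakTimeDeriv {F : Type*} [NormedAddCommGroup F] [NormedSpace ℝ F] (T : ℝ)
    (g g' : ℝ → F) : Prop :=
  ∀ φ : 𝓓((⟨Ioo 0 T, isOpen_Ioo⟩ : Opens ℝ), ℝ),
    ∫ t in Ioo 0 T, deriv φ t • g t = -∫ t in Ioo 0 T, φ t • g' t

/-- `u` belongs to the maximal regularity space `MR(V,V') = H¹(0,T;V') ∩ L²(0,T;V)`, and `u'` is its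
weak derivative in `L²(0,T;V')`. -/
structure MemMR (T : ℝ) (V : Submodule ℝ (H1 Ω)) (u : ℝ → V) (u' : ℝ → NDual V) :
    Prop where
  memLp : MemLp u 2 (volume.restrict (Ioo 0 T))
  memLp_deriv : MemLp u' 2 (volume.restrict (Ioo 0 T))
  hasWeakTimeDeriv : HasWeakTimeDeriv T (fun t => embDual V (u t)) u'

/-- `w` is the continuous representative in `C([0,T]; L²(Ω))` of a function `u ∈ MR(V,V')` which
solves the Cauchy problem `u̇(t) + 𝓐(t) u(t) = f(t)` for a.e. `t ∈ (0,T)`, `u(0) = u₀`, where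
`𝓐(t) : V → V'` is given by `⟨𝓐(t) y, v⟩ = 𝔞(t, y, v)`. -/
def IsSolution (T : ℝ) (V : Submodule ℝ (H1 Ω))
    (a : Fin d → Fin d → ℝ → EuclideanSpace ℝ (Fin d) → ℝ)
    (f : ℝ → NDual V) (u₀ : L2 Ω) (w : ℝ → L2 Ω) : Prop :=
  ∃ (u : ℝ → V) (u' : ℝ → NDual V),
    MemMR T V u u' ∧
    ContinuousOn w (Icc 0 T) ∧
    (∀ᵐ t ∂volume.restrict (Ioo 0 T), w t = emb V (u t)) ∧
    (∀ᵐ t ∂volume.restrict (Ioo 0 T), ∀ v : V, u' t v + form a t (u t : H1 Ω) (v : H1 Ω) = f t v) ∧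
    w 0 = u₀

/-- `f ≥ 0` for `f ∈ L²(0,T;V')`: for all `v ∈ V` with `v ≥ 0` one has `⟨f(t), v⟩ ≥ 0` for
a.e. `t`. -/
def DualNonneg (T : ℝ) (V : Submodule ℝ (H1 Ω)) (f : ℝ → NDual V) : Prop :=
  ∀ v : V, (∀ᵐ x ∂volume.restrict (Ω : Set (EuclideanSpace ℝ (Fin d))), 0 ≤ emb V v x) →
    ∀ᵐ t ∂volume.restrict (Ioo 0 T), 0 ≤ f t v

end NonautForm

end

/-! Both assertions are instances of one comparison principle, `IsSolution.le_const`: if c ≥ 0 and V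
is stable under v ↦ (v - c)⁺, then u₀ ≤ c forces u(t) ≤ c. Assertion 2 is c = 1; assertion 1 is c =
0 applied to -u.

The energy G(t) = ‖(u(t) - c)⁺‖² / 2 is continuous and vanishes at 0, so it suffices that it
decreases. A chain rule in time is avoided. Convexity (`norm_sq_posPartSub_sub_le`) and the
fundamental theorem in V' (`HasWeakTimeDeriv.sub_eq_integral`) bound G(r) - G(r - δ) by the integral
over (r - δ, r) of ⟨u'(σ), p⟩, where p = (u(r) - c)⁺ is frozen at the right endpoint. By the
equation and f ≤ 0 the integrand is at most -𝔞(σ, u(r), p) - 𝔞(σ, u(σ) - u(r), p). The first term is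
nonpositive by ellipticity, and the second is at most C ‖u(σ) - u(r)‖ ‖u(r)‖ in the norm of V.
Integrating over r and dividing by δ, the left side tends to G(t) - G(s) and the right side to 0,
because translations are continuous in L²(ℝ; V) (`le_of_increment_le`).

The sign of 𝔞(σ, v, (v - c)⁺) rests on ∇(v - c)⁺ = 1_{v > c} ∇v. Stability already places (v - c)⁺
in H¹, so this follows once weak derivatives are known to vanish on level sets
(`HasWeakPartial.ae_eq_zero_of_eq_const`), a consequence of the chain rule for smooth bounded
functions. -/

open Filter Topology
open scoped ENNReal NNReal Convolution ContDiff

/-! ### Translations and mollifications in L² -/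

section Translation

variable {G E : Type*} [NormedAddCommGroup G] [MeasurableSpace G] [BorelSpace G]
  [SecondCountableTopology G] [NormedAddCommGroup E] {μ : Measure G}

/-- Translations are continuous in `L²`. -/
theorem MeasureTheory.MemLp.tendsto_eLpNorm_translate_sub [ProperSpace G]
    [IsFiniteMeasureOnCompacts μ] [μ.IsAddLeftInvariant] {f : G → E} (hf : MemLp f 2 μ) :
    Tendsto (fun y => eLpNorm (fun x => f (x - y) - f x) 2 μ) (𝓝 0) (𝓝 0) := by
  -- Translations form a family of measure-preserving maps that is continuous in the compact-open
  -- topology, and composition in Lp is continuous along such families when p < ∞.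
  let τ : G → C(G, G) := fun y => ⟨fun x => x - y, by fun_prop⟩
  have hτ : Continuous τ := ContinuousMap.continuous_of_continuous_uncurry _ (by
    change Continuous fun p : G × G => p.2 - p.1
    fun_prop)
  have hm : ∀ y, MeasurePreserving (τ y) μ μ := fun y => measurePreserving_sub_right μ y
  have hc : Continuous fun y => Lp.compMeasurePreserving (τ y) (hm y) (hf.toLp f) :=
    continuous_const.compMeasurePreservingLp hτ hm (by simp)
  have h0 : Lp.compMeasurePreserving (τ 0) (hm 0) (hf.toLp f) = hf.toLp f := by
    rw [Lp.toLp_compMeasurePreserving]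
    congr 1
    ext x
    simp [τ]
  have h1 := (tendsto_iff_edist_tendsto_0.1 (hc.tendsto 0))
  rw [h0] at h1
  refine h1.congr fun y => ?_
  rw [Lp.toLp_compMeasurePreserving, Lp.edist_toLp_toLp]
  rfl

/-- An average of translation errors, tested against a weight `φ`. -/
theorem MeasureTheory.lintegral_mul_lintegral_translate_sub_le [SFinite μ] {f : G → E}
    (hf : StronglyMeasurable f)
    {φ k : G → ℝ≥0∞} (hφ : AEMeasurable φ μ) (hk : AEMeasurable k μ) {ε : ℝ≥0∞}
    (h : ∀ y, k y ≠ 0 → eLpNorm (fun x => f (x - y) - f x) 2 μ ≤ ε) :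
    ∫⁻ x, φ x * ∫⁻ y, k y * ‖f (x - y) - f x‖ₑ ∂μ ∂μ
      ≤ (∫⁻ y, k y ∂μ) * (eLpNorm φ 2 μ * ε) := by
  have hmeas : StronglyMeasurable fun p : G × G => f (p.1 - p.2) - f p.1 :=
    (hf.comp_measurable (measurable_fst.sub measurable_snd)).sub
      (hf.comp_measurable measurable_fst)
  calc ∫⁻ x, φ x * ∫⁻ y, k y * ‖f (x - y) - f x‖ₑ ∂μ ∂μ
      = ∫⁻ x, ∫⁻ y, φ x * (k y * ‖f (x - y) - f x‖ₑ) ∂μ ∂μ := by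
        refine lintegral_congr fun x => ?_
        rw [lintegral_const_mul'']
        exact hk.mul (hmeas.enorm.comp measurable_prodMk_left).aemeasurable
    _ = ∫⁻ y, ∫⁻ x, φ x * (k y * ‖f (x - y) - f x‖ₑ) ∂μ ∂μ := by
        refine lintegral_lintegral_swap ?_
        exact hφ.comp_fst.mul (hk.comp_snd.mul hmeas.enorm.aemeasurable)
    _ ≤ ∫⁻ y, k y * (eLpNorm φ 2 μ * ε) ∂μ := by
        refine lintegral_mono fun y => ?_
        by_cases hy : k y = 0
        · simp [hy]
        have hmy : AEMeasurable (fun x => ‖f (x - y) - f x‖ₑ) μ :=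
          (hmeas.enorm.comp measurable_prodMk_right).aemeasurable
        calc ∫⁻ x, φ x * (k y * ‖f (x - y) - f x‖ₑ) ∂μ
            = k y * ∫⁻ x, φ x * ‖f (x - y) - f x‖ₑ ∂μ := by
              rw [← lintegral_const_mul'' (f := fun x => φ x * ‖f (x - y) - f x‖ₑ) _ (hφ.mul hmy)]
              exact lintegral_congr fun x => by ring
          _ ≤ k y * (eLpNorm φ 2 μ * eLpNorm (fun x => f (x - y) - f x) 2 μ) := by
              gcongr
              have := ENNReal.lintegral_mul_le_Lp_mul_Lq μ
                (Real.HolderConjugate.two_two) hφ hmy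
              simpa [eLpNorm_eq_lintegral_rpow_enorm_toReal (p := 2) (by simp) (by simp)]
                using this
          _ ≤ k y * (eLpNorm φ 2 μ * ε) := by gcongr; exact h y hy
    _ = (∫⁻ y, k y ∂μ) * (eLpNorm φ 2 μ * ε) := lintegral_mul_const'' _ hk

end Translation

/-- Mollifications of an `L²` function converge in `L²`, in the weak form that is needed here. -/
theorem ContDiffBump.tendsto_lintegral_mul_convolution_sub
    {G : Type*} [NormedAddCommGroup G] [NormedSpace ℝ G] [FiniteDimensional ℝ G]
    [MeasurableSpace G] [BorelSpace G] {μ : Measure G} [μ.IsAddHaarMeasure]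
    {g : G → ℝ} (hgm : StronglyMeasurable g) (hg : MemLp g 2 μ)
    {φ : G → ℝ} (hφ : MemLp φ 2 μ) {b : ℕ → ContDiffBump (0 : G)}
    (hb : Tendsto (fun n => (b n).rOut) atTop (𝓝 0)) :
    Tendsto (fun n => ∫⁻ x, ‖φ x * (((b n).normed μ ⋆[ContinuousLinearMap.lsmul ℝ ℝ, μ] g) x
      - g x)‖ₑ ∂μ) atTop (𝓝 0) := by
  have hloc : LocallyIntegrable g μ := hg.locallyIntegrable (by norm_num)
  -- The kernel has integral one, so the mollification error is an average of translation errors.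
  have hpt : ∀ n x, ((b n).normed μ ⋆[ContinuousLinearMap.lsmul ℝ ℝ, μ] g) x - g x
      = ∫ y, (b n).normed μ y * (g (x - y) - g x) ∂μ := by
    intro n x
    have h1 : Integrable (fun y => (b n).normed μ y * g (x - y)) μ :=
      HasCompactSupport.convolutionExists_left (ContinuousLinearMap.lsmul ℝ ℝ)
        (b n).hasCompactSupport_normed (b n).continuous_normed hloc x
    simp_rw [mul_sub]
    rw [integral_sub h1 ((b n).integrable_normed.mul_const _), integral_mul_const,
      (b n).integral_normed, one_mul]
    rfl
  rw [ENNReal.tendsto_nhds_zero]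
  intro ε hε
  obtain ⟨ε', hε', hle⟩ : ∃ ε' : ℝ≥0∞, 0 < ε' ∧ eLpNorm φ 2 μ * ε' ≤ ε := by
    refine ⟨ε / (eLpNorm φ 2 μ + 1), ENNReal.div_pos hε.ne' (by simpa using hφ.eLpNorm_ne_top), ?_⟩
    rw [← mul_div_assoc]
    refine ENNReal.div_le_of_le_mul ?_
    rw [mul_comm]
    gcongr
    exact le_self_add
  have hτ := ENNReal.tendsto_nhds_zero.1 hg.tendsto_eLpNorm_translate_sub ε' hε'
  obtain ⟨δ, hδ, hball⟩ := Metric.eventually_nhds_iff.1 hτ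
  filter_upwards [hb.eventually_lt_const hδ] with n hn
  have key := lintegral_mul_lintegral_translate_sub_le (μ := μ) hgm (φ := fun x => ‖φ x‖ₑ)
    (k := fun y => ‖(b n).normed μ y‖ₑ) hφ.1.enorm
    (b n).continuous_normed.enorm.measurable.aemeasurable (ε := ε') (fun y hy => by
      refine hball ?_
      have : y ∈ Function.support ((b n).normed μ) := by simpa using hy
      rw [(b n).support_normed_eq] at this
      exact (Metric.mem_ball.1 this).trans hn)
  have hone : ∫⁻ y, ‖(b n).normed μ y‖ₑ ∂μ = 1 := by
    have := ofReal_integral_norm_eq_lintegral_enorm (b n).integrable_normed (μ := μ)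
    rw [← this]
    simp_rw [Real.norm_of_nonneg ((b n).nonneg_normed _)]
    simp [(b n).integral_normed]
  rw [hone, one_mul] at key
  have he : eLpNorm (fun x => ‖φ x‖ₑ) 2 μ = eLpNorm φ 2 μ := by
    exact eLpNorm_congr_enorm_ae (by simp)
  rw [he] at key
  refine le_trans (lintegral_mono fun x => ?_) (key.trans hle)
  rw [enorm_mul, hpt]
  gcongr
  refine (enorm_integral_le_lintegral_enorm _).trans (lintegral_mono fun y => ?_)
  rw [enorm_mul]

/-! ### Mollification and the chain rule for weak derivatives -/

namespace NonautForm

variable {d : ℕ} {Ω : Opens (EuclideanSpace ℝ (Fin d))}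

/-- Extension by zero of a function in `L²(Ω)`. -/
noncomputable def extend (u : L2 Ω) : EuclideanSpace ℝ (Fin d) → ℝ :=
  (Ω : Set (EuclideanSpace ℝ (Fin d))).indicator u

theorem stronglyMeasurable_extend (u : L2 Ω) : StronglyMeasurable (extend u) :=
  (Lp.stronglyMeasurable u).indicator Ω.isOpen.measurableSet

theorem memLp_extend (u : L2 Ω) : MemLp (extend u) 2 volume :=
  (memLp_indicator_iff_restrict Ω.isOpen.measurableSet).2 (Lp.memLp u)

theorem locallyIntegrable_extend (u : L2 Ω) : LocallyIntegrable (extend u) volume :=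
  (memLp_extend u).locallyIntegrable (by norm_num)

theorem extend_of_mem (u : L2 Ω) {x : EuclideanSpace ℝ (Fin d)} (hx : x ∈ Ω) :
    extend u x = u x := indicator_of_mem hx _

/-- The reflected kernel y ↦ ρ(x - y) is an admissible test function as soon as the closed ball
about x lies in Ω. The sign produced by the reflection cancels the one in the definition of the weak
derivative. -/
theorem fderiv_mollification {k : Fin d} {u g : L2 Ω} (h : HasWeakPartial Ω k u g)
    (b : ContDiffBump (0 : EuclideanSpace ℝ (Fin d))) {x : EuclideanSpace ℝ (Fin d)}
    (hx : Metric.closedBall x b.rOut ⊆ Ω) :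
    fderiv ℝ (b.normed volume ⋆[ContinuousLinearMap.lsmul ℝ ℝ] extend u) x
        (EuclideanSpace.single k 1)
      = (b.normed volume ⋆[ContinuousLinearMap.lsmul ℝ ℝ] extend g) x := by
  set ρ := b.normed (volume : Measure (EuclideanSpace ℝ (Fin d))) with hρ
  have hρc : ContDiff ℝ ∞ ρ := b.contDiff_normed
  have hρs : HasCompactSupport ρ := b.hasCompactSupport_normed
  have hsupp : tsupport (fun y => ρ (x - y)) ⊆ Metric.closedBall x b.rOut := by
    refine closure_minimal (fun y hy => ?_) Metric.isClosed_closedBall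
    have : x - y ∈ Function.support ρ := hy
    rw [hρ, b.support_normed_eq, mem_ball_zero_iff] at this
    rw [Metric.mem_closedBall, dist_eq_norm, ← norm_neg]
    simpa using this.le
  let ψ : 𝓓(Ω, ℝ) :=
    ⟨fun y => ρ (x - y), hρc.comp (contDiff_const.sub contDiff_id),
      HasCompactSupport.of_support_subset_isCompact (isCompact_closedBall x b.rOut)
        (subset_closure.trans hsupp), hsupp.trans hx⟩
  have hψ : ∀ y, ψ y = ρ (x - y) := fun _ => rfl
  have hdψ : ∀ y, fderiv ℝ ψ y (EuclideanSpace.single k 1)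
      = -fderiv ℝ ρ (x - y) (EuclideanSpace.single k 1) := by
    intro y
    have h1 : HasFDerivAt ρ (fderiv ℝ ρ (x - y)) (x - y) :=
      (hρc.differentiable (by simp) _).hasFDerivAt
    have h2 := h1.comp y ((hasFDerivAt_id y).const_sub x)
    have h3 : HasFDerivAt ψ _ y := h2
    rw [h3.fderiv]
    simp
  have hw := h ψ
  have hset : ∀ (w : L2 Ω) (θ : EuclideanSpace ℝ (Fin d) → ℝ),
      ∫ y in (Ω : Set (EuclideanSpace ℝ (Fin d))), w y * θ y = ∫ y, extend w y * θ y := by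
    intro w θ
    rw [← integral_indicator Ω.isOpen.measurableSet]
    congr 1
    ext y
    by_cases hy : y ∈ (Ω : Set (EuclideanSpace ℝ (Fin d))) <;> simp [extend, hy]
  rw [hset, hset] at hw
  have hd := hρs.hasFDerivAt_convolution_left (ContinuousLinearMap.lsmul ℝ ℝ)
    (hρc.of_le (by simp)) (locallyIntegrable_extend u) x
  rw [hd.fderiv, convolution_eq_swap, convolution_eq_swap,
    ContinuousLinearMap.integral_apply]
  · simp only [ContinuousLinearMap.precompL_apply, ContinuousLinearMap.lsmul_apply, smul_eq_mul]
    rw [← neg_inj, ← integral_neg]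
    calc _ = ∫ y, extend u y * fderiv ℝ ψ y (EuclideanSpace.single k 1) := by
          refine integral_congr_ae (.of_forall fun y => ?_)
          simp only [hdψ]; ring
      _ = _ := by
          rw [hw]
          congr 1
          refine integral_congr_ae (.of_forall fun y => ?_)
          simp only [hψ]; ring
  · have := HasCompactSupport.convolutionExists_left
      ((ContinuousLinearMap.lsmul ℝ ℝ : ℝ →L[ℝ] ℝ →L[ℝ] ℝ).precompL (EuclideanSpace ℝ (Fin d)))
      (hρs.fderiv ℝ) (hρc.continuous_fderiv (by simp)) (locallyIntegrable_extend u) x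
    exact this.integrable_swap

/-- The chain rule for weak derivatives, for bounded `F` with bounded derivative. -/
theorem HasWeakPartial.integral_comp {k : Fin d} {u g : L2 Ω} (h : HasWeakPartial Ω k u g)
    {F : ℝ → ℝ} (hF : ContDiff ℝ 1 F) {C : ℝ} (hC : ∀ s, |F s| ≤ C) (hC' : ∀ s, |deriv F s| ≤ C)
    (φ : 𝓓(Ω, ℝ)) :
    ∫ x in (Ω : Set (EuclideanSpace ℝ (Fin d))),
        F (u x) * fderiv ℝ φ x (EuclideanSpace.single k 1)
      = -∫ x in (Ω : Set (EuclideanSpace ℝ (Fin d))), deriv F (u x) * g x * φ x := by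
  set e : EuclideanSpace ℝ (Fin d) := EuclideanSpace.single k 1 with he
  -- The test function and its derivative vanish off Ω, so all integrals may be taken over the whole
  -- space with u and g extended by zero.
  have hset : ∀ (θ η : EuclideanSpace ℝ (Fin d) → ℝ), (∀ x ∈ Ω, θ x = η x) → (∀ x ∉ Ω, η x = 0) →
      ∫ y in (Ω : Set (EuclideanSpace ℝ (Fin d))), θ y = ∫ y, η y := by
    intro θ η h1 h2
    exact (setIntegral_congr_fun Ω.isOpen.measurableSet h1).trans
      (setIntegral_eq_integral_of_forall_compl_eq_zero h2)
  have hφ0 : ∀ x ∉ Ω, φ x = 0 := fun x hx =>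
    image_eq_zero_of_notMem_tsupport fun h' => hx (φ.tsupport_subset h')
  have hdφ0 : ∀ x ∉ Ω, fderiv ℝ φ x e = 0 := fun x hx => by
    rw [fderiv_of_notMem_tsupport (𝕜 := ℝ) fun h' => hx (φ.tsupport_subset h')]; rfl
  rw [hset _ (fun x => F (extend u x) * fderiv ℝ φ x e)
      (fun x hx => by rw [extend_of_mem u hx]) (fun x hx => by rw [hdφ0 x hx, mul_zero]),
    hset _ (fun x => deriv F (extend u x) * extend g x * φ x)
      (fun x hx => by rw [extend_of_mem u hx, extend_of_mem g hx])
      (fun x hx => by rw [hφ0 x hx, mul_zero])]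
  -- The inner radius is half the outer one: almost everywhere convergence of mollifications asks
  -- for a bounded ratio, here `K = 2`.
  let b : ℕ → ContDiffBump (0 : EuclideanSpace ℝ (Fin d)) := fun n =>
    ⟨1 / ((n : ℝ) + 1) / 2, 1 / ((n : ℝ) + 1), by positivity, half_lt_self (by positivity)⟩
  have hb : Tendsto (fun n => (b n).rOut) atTop (𝓝 0) := tendsto_one_div_add_atTop_nhds_zero_nat
  let U : ℕ → EuclideanSpace ℝ (Fin d) → ℝ := fun n =>
    (b n).normed volume ⋆[ContinuousLinearMap.lsmul ℝ ℝ] extend u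
  let Γ : ℕ → EuclideanSpace ℝ (Fin d) → ℝ := fun n =>
    (b n).normed volume ⋆[ContinuousLinearMap.lsmul ℝ ℝ] extend g
  have hU1 : ∀ n, ContDiff ℝ 1 (U n) := fun n =>
    HasCompactSupport.contDiff_convolution_left (n := 1) (ContinuousLinearMap.lsmul ℝ ℝ)
      (b n).hasCompactSupport_normed (b n).contDiff_normed (locallyIntegrable_extend u)
  have hΓc : ∀ n, Continuous (Γ n) := fun n =>
    (HasCompactSupport.contDiff_convolution_left (n := 1) (ContinuousLinearMap.lsmul ℝ ℝ)
      (b n).hasCompactSupport_normed (b n).contDiff_normed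
      (locallyIntegrable_extend g)).continuous
  have hUlim : ∀ᵐ x, Tendsto (fun n => U n x) atTop (𝓝 (extend u x)) :=
    ContDiffBump.ae_convolution_tendsto_right_of_locallyIntegrable hb (K := 2)
      (.of_forall fun n => by simp only [b]; linarith) (locallyIntegrable_extend u)
  have hdF : Continuous (deriv F) := hF.continuous_deriv le_rfl
  have hdφc := continuous_fderiv_test φ e
  have hdφs := hasCompactSupport_fderiv_test φ e
  have hgφ : Integrable (fun x => extend g x * φ x) volume :=
    (memLp_extend g).integrable_mul (q := 2)
      (φ.continuous.memLp_of_hasCompactSupport φ.hasCompactSupport)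
  -- the identity for the mollified functions
  have hn : ∀ᶠ n in atTop, ∫ x, F (U n x) * fderiv ℝ φ x e
      = -∫ x, deriv F (U n x) * Γ n x * φ x := by
    -- The support of φ keeps a positive distance δ from the complement of Ω, so for radii below δ
    -- the formula for the derivative of the mollification holds at every point of the support.
    obtain ⟨δ, hδ, hδs⟩ := φ.hasCompactSupport.isCompact.exists_cthickening_subset_open
      Ω.isOpen φ.tsupport_subset
    filter_upwards [hb.eventually_lt_const hδ] with n hn
    have hder : ∀ x, fderiv ℝ (fun y => F (U n y)) x e
        = deriv F (U n x) * fderiv ℝ (U n) x e := by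
      intro x
      have h1 : HasDerivAt F (deriv F (U n x)) (U n x) :=
        (hF.differentiable one_ne_zero _).hasDerivAt
      have h2 := h1.comp_hasFDerivAt x ((hU1 n).differentiable one_ne_zero x).hasFDerivAt
      have h3 : HasFDerivAt (fun y => F (U n y)) _ x := h2
      rw [h3.fderiv]
      simp
    have hFU : ContDiff ℝ 1 fun y => F (U n y) := hF.comp (hU1 n)
    rw [integral_mul_fderiv_eq_neg_fderiv_mul_of_integrable
      (f := fun y => F (U n y)) (g := φ) (v := e)]
    · congr 1
      refine integral_congr_ae (.of_forall fun x => ?_)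
      simp only [hder]
      by_cases hx : x ∈ tsupport φ
      · have hball : Metric.closedBall x (b n).rOut ⊆ Ω :=
          (Metric.closedBall_subset_closedBall hn.le).trans
            ((Metric.closedBall_subset_cthickening hx δ).trans hδs)
        rw [fderiv_mollification h (b n) hball]
      · simp [image_eq_zero_of_notMem_tsupport hx]
    · exact ((hFU.continuous_fderiv one_ne_zero).clm_apply continuous_const |>.mul
        φ.continuous).integrable_of_hasCompactSupport φ.hasCompactSupport.mul_left
    · exact (hFU.continuous.mul hdφc).integrable_of_hasCompactSupport hdφs.mul_left
    · exact (hFU.continuous.mul φ.continuous).integrable_of_hasCompactSupport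
        φ.hasCompactSupport.mul_left
    · exact fun x _ => hFU.differentiable one_ne_zero x
    · exact fun x _ => (φ.contDiff.differentiable (by simp)) x
  have hL : Tendsto (fun n => ∫ x, F (U n x) * fderiv ℝ φ x e) atTop
      (𝓝 (∫ x, F (extend u x) * fderiv ℝ φ x e)) := by
    refine tendsto_integral_of_dominated_convergence (fun x => C * |fderiv ℝ φ x e|) ?_ ?_ ?_ ?_
    · exact fun n => ((hF.continuous.comp (hU1 n).continuous).mul hdφc).aestronglyMeasurable
    · exact ((hdφc.integrable_of_hasCompactSupport hdφs).abs).const_mul C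
    · refine fun n => .of_forall fun x => ?_
      rw [Real.norm_eq_abs, abs_mul]
      gcongr
      exact hC _
    · filter_upwards [hUlim] with x hx
      exact ((hF.continuous.tendsto _).comp hx).mul_const _
  -- The right side is split with Γₙ = g + (Γₙ - g): the g part converges by domination, since Uₙ →
  -- u almost everywhere, and the error part by L² convergence of mollifications against φ, as F' is
  -- bounded.
  have hR1 : Tendsto (fun n => ∫ x, deriv F (U n x) * (extend g x * φ x)) atTop
      (𝓝 (∫ x, deriv F (extend u x) * (extend g x * φ x))) := by
    refine tendsto_integral_of_dominated_convergence (fun x => C * |extend g x * φ x|) ?_ ?_ ?_ ?_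
    · exact fun n => (hdF.comp (hU1 n).continuous).aestronglyMeasurable.mul hgφ.1
    · exact hgφ.abs.const_mul C
    · refine fun n => .of_forall fun x => ?_
      rw [Real.norm_eq_abs, abs_mul]
      gcongr
      exact hC' _
    · filter_upwards [hUlim] with x hx
      exact ((hdF.tendsto _).comp hx).mul_const _
  have hR2 : Tendsto (fun n => ∫ x, deriv F (U n x) * (φ x * (Γ n x - extend g x))) atTop
      (𝓝 0) := by
    have hM := ContDiffBump.tendsto_lintegral_mul_convolution_sub
      (stronglyMeasurable_extend g) (memLp_extend g)
      (φ.continuous.memLp_of_hasCompactSupport φ.hasCompactSupport) hb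
    rw [tendsto_zero_iff_enorm_tendsto_zero]
    have hM' := ENNReal.Tendsto.const_mul (a := ENNReal.ofReal C) hM (Or.inr (by simp))
    rw [mul_zero] at hM'
    refine tendsto_of_tendsto_of_tendsto_of_le_of_le tendsto_const_nhds hM'
      (fun _ => zero_le) fun n => ?_
    refine (enorm_integral_le_lintegral_enorm _).trans ?_
    rw [← lintegral_const_mul' _ _ (by simp)]
    refine lintegral_mono fun x => ?_
    rw [enorm_mul]
    gcongr
    rw [Real.enorm_eq_ofReal_abs]
    exact ENNReal.ofReal_le_ofReal (hC' _)
  have hR : Tendsto (fun n => -∫ x, deriv F (U n x) * Γ n x * φ x) atTop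
      (𝓝 (-∫ x, deriv F (extend u x) * extend g x * φ x)) := by
    have hbd : ∀ n, ∀ᵐ x, ‖deriv F (U n x)‖ ≤ C := fun n => .of_forall fun x => hC' _
    have hsum := (hR1.add hR2).neg
    rw [add_zero] at hsum
    simp_rw [mul_assoc]
    refine hsum.congr fun n => ?_
    rw [← integral_add]
    · congr 1
      refine integral_congr_ae (.of_forall fun x => ?_)
      ring
    · exact hgφ.bdd_mul (hdF.comp (hU1 n).continuous).aestronglyMeasurable (hbd n)
    · refine Integrable.bdd_mul ?_ (hdF.comp (hU1 n).continuous).aestronglyMeasurable (hbd n)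
      simp_rw [mul_sub]
      refine Integrable.sub ?_ (hgφ.congr (.of_forall fun x => mul_comm _ _))
      exact (φ.continuous.mul (hΓc n)).integrable_of_hasCompactSupport
        φ.hasCompactSupport.mul_right
  exact tendsto_nhds_unique (hL.congr' hn) hR

end NonautForm

/-! ### Level sets, truncation in H¹ and the form -/

namespace NonautForm

variable {d : ℕ} {Ω : Opens (EuclideanSpace ℝ (Fin d))}

/-- The weak derivative of `u` vanishes almost everywhere on each level set of `u`. -/
theorem HasWeakPartial.ae_eq_zero_of_eq_const {k : Fin d} {u g : L2 Ω}
    (h : HasWeakPartial Ω k u g) (c : ℝ) :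
    ∀ᵐ x ∂volume.restrict (Ω : Set (EuclideanSpace ℝ (Fin d))), u x = c → g x = 0 := by
  have hlevel : MeasurableSet {x | u x = c} :=
    (Lp.stronglyMeasurable u).measurable (measurableSet_singleton c)
  have hloc : LocallyIntegrable ({x | u x = c}.indicator (extend g)) volume :=
    ((memLp_extend g).indicator hlevel).locallyIntegrable (by norm_num)
  have key : ∀ᵐ x, x ∈ (Ω : Set (EuclideanSpace ℝ (Fin d))) →
      {x | u x = c}.indicator (extend g) x = 0 := by
    refine Ω.isOpen.ae_eq_zero_of_integral_contDiff_smul_eq_zero (hloc.locallyIntegrableOn _)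
      fun θ hθ hθc hθs => ?_
    let φ : 𝓓(Ω, ℝ) := ⟨θ, hθ, hθc, hθs⟩
    have hφ0 : ∀ x ∉ (Ω : Set (EuclideanSpace ℝ (Fin d))), θ x = 0 := fun x hx =>
      image_eq_zero_of_notMem_tsupport fun h' => hx (hθs h')
    -- Fₙ tends to 0 uniformly while Fₙ' is bounded by 1 and tends pointwise to the indicator of
    -- {c}. In the limit the chain rule says that g integrates to 0 over {u = c} against every test
    -- function.
    let F : ℕ → ℝ → ℝ := fun n s => Real.arctan ((n + 1) * (s - c)) / (n + 1)
    have hFc : ∀ n, ContDiff ℝ 1 (F n) := fun n =>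
      (Real.contDiff_arctan.comp (contDiff_const.mul (contDiff_id.sub contDiff_const))).div_const _
    have hFb : ∀ n s, |F n s| ≤ 2 / (n + 1) := fun n s => by
      simp only [F, abs_div]
      rw [abs_of_pos (by positivity : (0 : ℝ) < n + 1)]
      gcongr
      have h1 := Real.arctan_lt_pi_div_two ((n + 1) * (s - c))
      have h2 := Real.neg_pi_div_two_lt_arctan ((n + 1) * (s - c))
      have h3 := Real.pi_lt_four
      exact abs_le.2 ⟨by linarith, by linarith⟩
    have hFb' : ∀ n s, |F n s| ≤ 2 := fun n s =>
      (hFb n s).trans (div_le_self (by norm_num) (by linarith [(Nat.cast_nonneg n : (0 : ℝ) ≤ n)]))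
    have hFd : ∀ n s, deriv (F n) s = 1 / (1 + ((n + 1) * (s - c)) ^ 2) := by
      intro n s
      have h1 : HasDerivAt (fun s : ℝ => (n + 1 : ℝ) * (s - c)) ((n + 1) * 1) s :=
        ((hasDerivAt_id s).sub_const c).const_mul _
      have h2 := (h1.arctan).div_const ((n : ℝ) + 1)
      refine h2.deriv.trans ?_
      have : (n : ℝ) + 1 ≠ 0 := by positivity
      field_simp
    have hFdb : ∀ n s, |deriv (F n) s| ≤ 1 := fun n s => by
      rw [hFd, abs_of_pos (by positivity), div_le_one (by positivity)]
      nlinarith [sq_nonneg (((n : ℝ) + 1) * (s - c))]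
    have hgφ : Integrable (fun x => g x * θ x)
        (volume.restrict (Ω : Set (EuclideanSpace ℝ (Fin d)))) :=
      integrable_L2_mul g φ.continuous hθc
    have hum : AEStronglyMeasurable (fun x => u x)
        (volume.restrict (Ω : Set (EuclideanSpace ℝ (Fin d)))) :=
      (Lp.stronglyMeasurable u).aestronglyMeasurable
    have hL : Tendsto (fun n => ∫ x in (Ω : Set (EuclideanSpace ℝ (Fin d))),
        F n (u x) * fderiv ℝ φ x (EuclideanSpace.single k 1)) atTop
        (𝓝 (∫ x in (Ω : Set (EuclideanSpace ℝ (Fin d))), (0 : ℝ))) := by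
      have hdi := (continuous_fderiv_test φ
        (EuclideanSpace.single k 1)).integrable_of_hasCompactSupport
        (hasCompactSupport_fderiv_test φ (EuclideanSpace.single k 1)) (μ := volume) |>.restrict
        (s := (Ω : Set (EuclideanSpace ℝ (Fin d))))
      refine tendsto_integral_of_dominated_convergence
        (fun x => 2 * |fderiv ℝ φ x (EuclideanSpace.single k 1)|) ?_ ?_ ?_ ?_
      · exact fun n => ((hFc n).continuous.comp_aestronglyMeasurable hum).mul hdi.1
      · exact hdi.abs.const_mul 2
      · refine fun n => .of_forall fun x => ?_
        rw [Real.norm_eq_abs, abs_mul]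
        gcongr
        exact hFb' _ _
      · refine .of_forall fun x => ?_
        rw [← zero_mul (fderiv ℝ φ x (EuclideanSpace.single k 1))]
        refine Tendsto.mul_const _ ?_
        refine squeeze_zero_norm (fun n => hFb n (u x)) ?_
        have := tendsto_one_div_add_atTop_nhds_zero_nat (𝕜 := ℝ) |>.const_mul 2
        simpa [div_eq_mul_inv] using this
    have hR : Tendsto (fun n => ∫ x in (Ω : Set (EuclideanSpace ℝ (Fin d))),
        deriv (F n) (u x) * g x * φ x) atTop
        (𝓝 (∫ x in (Ω : Set (EuclideanSpace ℝ (Fin d))),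
          {x | u x = c}.indicator (fun x => g x * θ x) x)) := by
      refine tendsto_integral_of_dominated_convergence (fun x => |g x * θ x|) ?_ ?_ ?_ ?_
      · intro n
        simp_rw [mul_assoc]
        exact (((hFc n).continuous_deriv le_rfl).comp_aestronglyMeasurable hum).mul hgφ.1
      · exact hgφ.abs
      · refine fun n => .of_forall fun x => ?_
        rw [Real.norm_eq_abs, mul_assoc, abs_mul]
        exact mul_le_of_le_one_left (abs_nonneg _) (hFdb _ _)
      · refine .of_forall fun x => ?_
        simp_rw [mul_assoc]
        by_cases hx : u x = c
        · rw [indicator_of_mem (by exact hx)]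
          simp only [hFd, hx]
          simp [φ]
        · rw [indicator_of_notMem (by exact hx), ← zero_mul (g x * φ x)]
          refine Tendsto.mul_const _ ?_
          simp_rw [hFd, mul_pow]
          refine Tendsto.const_div_atTop ?_ _
          refine tendsto_atTop_add_const_left _ _ ?_
          refine Tendsto.atTop_mul_const (pow_pos (abs_pos.2 (sub_ne_zero.2 hx)) 2 |>.trans_eq
            (sq_abs _)) ?_
          exact (tendsto_pow_atTop two_ne_zero).comp
            (tendsto_atTop_add_const_right _ _ tendsto_natCast_atTop_atTop)
    have heq : ∀ n, ∫ x in (Ω : Set (EuclideanSpace ℝ (Fin d))),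
        F n (u x) * fderiv ℝ φ x (EuclideanSpace.single k 1)
        = -∫ x in (Ω : Set (EuclideanSpace ℝ (Fin d))), deriv (F n) (u x) * g x * φ x := fun n =>
      h.integral_comp (hFc n) (hFb' n) (fun s => (hFdb n s).trans one_le_two) φ
    have hlim := tendsto_nhds_unique hL (hR.neg.congr fun n => (heq n).symm)
    rw [integral_zero, zero_eq_neg] at hlim
    rw [← hlim, ← setIntegral_eq_integral_of_forall_compl_eq_zero
      (s := (Ω : Set (EuclideanSpace ℝ (Fin d)))) (fun x hx => by rw [hφ0 x hx, zero_smul])]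
    refine setIntegral_congr_fun Ω.isOpen.measurableSet fun x hx => ?_
    by_cases hxc : x ∈ {x | u x = c}
    · simp only [indicator_of_mem hxc, extend_of_mem g hx, smul_eq_mul, mul_comm]
    · simp only [indicator_of_notMem hxc, smul_zero]
  rw [ae_restrict_iff' Ω.isOpen.measurableSet]
  filter_upwards [key] with x hx hxΩ hxc
  rw [← hx hxΩ, indicator_of_mem (by exact hxc), extend_of_mem g hxΩ]

theorem hasWeakPartial_partialD (k : Fin d) (v : H1 Ω) :
    HasWeakPartial Ω k (toL2 v) (partialD k v) := v.2 k

theorem partialD_sub (k : Fin d) (v w : H1 Ω) :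
    partialD k (v - w) = partialD k v - partialD k w := rfl

/-- The weak derivatives of `(v - c)⁺`. -/
theorem partialD_of_posPart {v p : H1 Ω} {c : ℝ}
    (hp : ∀ᵐ x ∂volume.restrict (Ω : Set (EuclideanSpace ℝ (Fin d))),
      toL2 p x = max (toL2 v x - c) 0) (k : Fin d) :
    ∀ᵐ x ∂volume.restrict (Ω : Set (EuclideanSpace ℝ (Fin d))),
      partialD k p x = if c < toL2 v x then partialD k v x else 0 := by
  -- At almost every point either p = 0 or v - p = c. The level-set result for these two functions
  -- therefore determines the derivative of p, with no chain rule for the maximum.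
  have h1 := (hasWeakPartial_partialD k p).ae_eq_zero_of_eq_const 0
  have h2 := (hasWeakPartial_partialD k (v - p)).ae_eq_zero_of_eq_const c
  rw [map_sub, partialD_sub] at h2
  filter_upwards [hp, h1, h2, Lp.coeFn_sub (toL2 v) (toL2 p),
    Lp.coeFn_sub (partialD k v) (partialD k p)] with x hx h1x h2x hs hs'
  rw [hs, hs', Pi.sub_apply, Pi.sub_apply, hx] at h2x
  split_ifs with hc
  · rw [max_eq_left (by linarith)] at h2x
    linarith [h2x (by ring)]
  · exact h1x (hx.trans (max_eq_right (by linarith)))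

theorem H1.norm_sq_eq (v : H1 Ω) : ‖v‖ ^ 2 = ‖toL2 v‖ ^ 2 + ∑ k, ‖partialD k v‖ ^ 2 := by
  have h1 : ‖v‖ = ‖v.1‖ := rfl
  rw [h1, WithLp.prod_norm_sq_eq_of_L2, PiLp.norm_sq_eq_of_L2]
  rfl

theorem norm_partialD_le (k : Fin d) (v : H1 Ω) : ‖partialD k v‖ ≤ ‖v‖ := by
  refine le_of_sq_le_sq ?_ (norm_nonneg v)
  rw [H1.norm_sq_eq]
  have := Finset.single_le_sum (f := fun k => ‖partialD k v‖ ^ 2) (fun _ _ => sq_nonneg _)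
    (Finset.mem_univ k)
  linarith [sq_nonneg ‖toL2 v‖]

/-- Truncation shrinks each part of the norm: 0 ≤ (v - c)⁺ ≤ |v| because c ≥ 0, and the derivatives
are merely cut off to {v > c}. -/
theorem norm_le_of_posPart {v p : H1 Ω} {c : ℝ} (hc : 0 ≤ c)
    (hp : ∀ᵐ x ∂volume.restrict (Ω : Set (EuclideanSpace ℝ (Fin d))),
      toL2 p x = max (toL2 v x - c) 0) : ‖p‖ ≤ ‖v‖ := by
  refine le_of_sq_le_sq ?_ (norm_nonneg v)
  rw [H1.norm_sq_eq, H1.norm_sq_eq]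
  gcongr with k
  · refine Lp.norm_le_norm_of_ae_le ?_
    filter_upwards [hp] with x hx
    rw [hx, Real.norm_eq_abs, Real.norm_eq_abs, abs_of_nonneg (le_max_right _ _)]
    exact max_le (by linarith [le_abs_self (toL2 v x)]) (abs_nonneg _)
  · refine Lp.norm_le_norm_of_ae_le ?_
    filter_upwards [partialD_of_posPart hp k] with x hx
    rw [hx]
    split_ifs
    · rfl
    · simp

theorem integrable_mul_L2 (f g : L2 Ω) : Integrable (fun x => f x * g x)
    (volume.restrict (Ω : Set (EuclideanSpace ℝ (Fin d)))) :=
  (Lp.memLp f).integrable_mul (q := 2) (Lp.memLp g)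

theorem integral_abs_mul_le (f g : L2 Ω) :
    ∫ x in (Ω : Set (EuclideanSpace ℝ (Fin d))), |f x * g x| ≤ ‖f‖ * ‖g‖ := by
  have h := real_inner_le_norm (|f| : L2 Ω) (|g| : L2 Ω)
  rw [norm_abs_eq_norm f, norm_abs_eq_norm g, L2.inner_def] at h
  refine (integral_congr_ae ?_).trans_le h
  filter_upwards [Lp.coeFn_abs f, Lp.coeFn_abs g] with x hf hg
  rw [hf, hg, abs_mul]
  simp [mul_comm]

variable {a : Fin d → Fin d → ℝ → EuclideanSpace ℝ (Fin d) → ℝ}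

theorem abs_form_le {t M : ℝ} (hM : 0 ≤ M) (h : ∀ k j, ∀ x ∈ Ω, |a k j t x| ≤ M) (u v : H1 Ω) :
    |form a t u v| ≤ d * d * M * ‖u‖ * ‖v‖ := by
  have h1 : ∀ k j, |∫ x in (Ω : Set (EuclideanSpace ℝ (Fin d))),
      a k j t x * partialD k u x * partialD j v x| ≤ M * ‖u‖ * ‖v‖ := by
    intro k j
    rw [← Real.norm_eq_abs]
    calc _ ≤ ∫ x in (Ω : Set (EuclideanSpace ℝ (Fin d))),
            M * |partialD k u x * partialD j v x| := by
          refine norm_integral_le_of_norm_le ((integrable_mul_L2 _ _).abs.const_mul M) ?_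
          filter_upwards [ae_restrict_mem Ω.isOpen.measurableSet] with x hx
          rw [mul_assoc, norm_mul]
          exact mul_le_mul_of_nonneg_right (h k j x hx) (norm_nonneg _)
      _ ≤ M * (‖partialD k u‖ * ‖partialD j v‖) := by
          rw [integral_const_mul]
          exact mul_le_mul_of_nonneg_left (integral_abs_mul_le _ _) hM
      _ ≤ M * ‖u‖ * ‖v‖ := by
          rw [mul_assoc]
          gcongr <;> exact norm_partialD_le _ _
  calc |form a t u v| ≤ ∑ k, ∑ j, M * ‖u‖ * ‖v‖ :=
        (Finset.abs_sum_le_sum_abs _ _).trans (Finset.sum_le_sum fun k _ =>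
          (Finset.abs_sum_le_sum_abs _ _).trans (Finset.sum_le_sum fun j _ => h1 k j))
    _ = d * d * M * ‖u‖ * ‖v‖ := by simp; ring

theorem integrable_form {t M : ℝ} {k j : Fin d} (h : ∀ x ∈ Ω, |a k j t x| ≤ M)
    (hm : AEStronglyMeasurable (a k j t)
      (volume.restrict (Ω : Set (EuclideanSpace ℝ (Fin d))))) (u v : H1 Ω) :
    Integrable (fun x => a k j t x * partialD k u x * partialD j v x)
      (volume.restrict (Ω : Set (EuclideanSpace ℝ (Fin d)))) := by
  simp_rw [mul_assoc]
  refine (integrable_mul_L2 _ _).bdd_mul hm (c := M) ?_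
  filter_upwards [ae_restrict_mem Ω.isOpen.measurableSet] with x hx using h x hx

theorem form_sub_left {t M : ℝ} (h : ∀ k j, ∀ x ∈ Ω, |a k j t x| ≤ M)
    (hm : ∀ k j, AEStronglyMeasurable (a k j t)
      (volume.restrict (Ω : Set (EuclideanSpace ℝ (Fin d))))) (u w v : H1 Ω) :
    form a t (u - w) v = form a t u v - form a t w v := by
  simp only [form, ← Finset.sum_sub_distrib]
  refine Finset.sum_congr rfl fun k _ => Finset.sum_congr rfl fun j _ => ?_
  rw [← integral_sub (integrable_form (h k j) (hm k j) u v)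
    (integrable_form (h k j) (hm k j) w v), partialD_sub]
  refine integral_congr_ae ?_
  filter_upwards [Lp.coeFn_sub (partialD k u) (partialD k w)] with x hx
  rw [hx, Pi.sub_apply]
  ring

/-- On {v > c} the gradients of v and p agree, so the integrand is the quadratic form of the
coefficients at ∇v; elsewhere ∇p = 0. -/
theorem form_nonneg_of_posPart {t M : ℝ} (h : ∀ k j, ∀ x ∈ Ω, |a k j t x| ≤ M)
    (hm : ∀ k j, AEStronglyMeasurable (a k j t)
      (volume.restrict (Ω : Set (EuclideanSpace ℝ (Fin d)))))
    (he : ∀ᵐ x ∂volume.restrict (Ω : Set (EuclideanSpace ℝ (Fin d))),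
      ∀ ξ : EuclideanSpace ℝ (Fin d), 0 ≤ ∑ k, ∑ j, a k j t x * ξ k * ξ j)
    {v p : H1 Ω} {c : ℝ}
    (hp : ∀ᵐ x ∂volume.restrict (Ω : Set (EuclideanSpace ℝ (Fin d))),
      toL2 p x = max (toL2 v x - c) 0) : 0 ≤ form a t v p := by
  have hsum : form a t v p = ∫ x in (Ω : Set (EuclideanSpace ℝ (Fin d))),
      ∑ k, ∑ j, a k j t x * partialD k v x * partialD j p x := by
    rw [integral_finsetSum _ fun k _ => integrable_finsetSum _ fun j _ =>
      integrable_form (h k j) (hm k j) v p]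
    exact Finset.sum_congr rfl fun k _ =>
      (integral_finsetSum _ fun j _ => integrable_form (h k j) (hm k j) v p).symm
  rw [hsum]
  refine integral_nonneg_of_ae ?_
  filter_upwards [he, ae_all_iff.2 (partialD_of_posPart hp)] with x hx hpx
  simp only [hpx, Pi.zero_apply]
  split_ifs
  · exact hx (WithLp.toLp 2 fun k => partialD k v x)
  · simp

/-- For almost every time, the coefficients are measurable, bounded and elliptic in space. -/
theorem IsEllipticCoeff.ae_slice {T : ℝ} (ha : IsEllipticCoeff T Ω a) :
    ∀ᵐ t ∂volume.restrict (Ioo 0 T),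
      (∀ k j, AEStronglyMeasurable (a k j t)
        (volume.restrict (Ω : Set (EuclideanSpace ℝ (Fin d))))) ∧
      ∀ᵐ x ∂volume.restrict (Ω : Set (EuclideanSpace ℝ (Fin d))),
        ∀ ξ : EuclideanSpace ℝ (Fin d), 0 ≤ ∑ k, ∑ j, a k j t x * ξ k * ξ j := by
  refine ae_restrict_of_ae_restrict_of_subset Ioo_subset_Icc_self ?_
  have hprod : (volume.restrict (Icc 0 T ×ˢ (Ω : Set (EuclideanSpace ℝ (Fin d)))) :
      Measure (ℝ × EuclideanSpace ℝ (Fin d)))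
      = (volume.restrict (Icc 0 T)).prod
        (volume.restrict (Ω : Set (EuclideanSpace ℝ (Fin d)))) := by
    rw [Measure.prod_restrict]; rfl
  obtain ⟨η, hη, he⟩ := ha.elliptic
  have hm := ha.measurable
  rw [hprod] at he
  simp_rw [hprod] at hm
  filter_upwards [Measure.ae_ae_of_ae_prod he, ae_all_iff.2 fun k => ae_all_iff.2 fun j =>
    (hm k j).aestronglyMeasurable.prodMk_left] with t h1 h2
  refine ⟨h2, ?_⟩
  filter_upwards [h1] with x hx ξ
  exact (by positivity : 0 ≤ η * ‖ξ‖ ^ 2).trans (hx ξ)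

/-- Separability supplies the dense sequence of nonnegative elements used in `DualNonneg.ae_forall`.
-/
instance : SecondCountableTopology (L2 Ω) :=
  haveI : Fact ((2 : ℝ≥0∞) ≠ ⊤) := ⟨by simp⟩
  inferInstance

instance : SecondCountableTopology (H1 Ω) := by
  have h1 : IsInducing (fun v : H1 Ω => v.1) := IsInducing.subtypeVal
  exact h1.secondCountableTopology

end NonautForm

/-! ### Weak time derivatives and monotonicity from increments -/

/-- A smooth approximation of the Heaviside function whose derivative is a given bump. -/
theorem ContDiffBump.exists_primitive (b : ContDiffBump (0 : ℝ)) (hb : b.rOut ≤ 1) :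
    ∃ P : ℝ → ℝ, ContDiff ℝ ∞ P ∧ (∀ x, HasDerivAt P (b.normed volume x) x) ∧
      (∀ x ≤ -b.rOut, P x = 0) ∧ (∀ x ≥ b.rOut, P x = 1) ∧ ∀ x, |P x| ≤ 1 := by
  set ρ := b.normed volume with hρ
  have hρc : Continuous ρ := b.continuous_normed
  have hρ0 : ∀ x, b.rOut ≤ |x| → ρ x = 0 := fun x hx => by
    have : x ∉ Function.support ρ := by
      rw [hρ, b.support_normed_eq]
      simpa using hx
    simpa using this
  -- The base point -1 lies to the left of the support, as the outer radius is at most 1.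
  have hder : ∀ x, HasDerivAt (fun x => ∫ y in (-1)..x, ρ y) (ρ x) x := fun x =>
    hρc.integral_hasStrictDerivAt (-1) x |>.hasDerivAt
  refine ⟨fun x => ∫ y in (-1)..x, ρ y, ?_, hder, ?_, ?_, ?_⟩
  · rw [contDiff_infty_iff_deriv]
    refine ⟨fun x => (hder x).differentiableAt, ?_⟩
    rw [funext fun x => (hder x).deriv]
    exact b.contDiff_normed
  · intro x hx
    refine intervalIntegral.integral_zero_ae (.of_forall fun y hy => hρ0 y ?_)
    have : y ≤ -b.rOut := by
      rcases mem_uIoc.1 hy with h | h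
      · exact h.2.trans hx
      · linarith [h.2]
    rw [abs_of_nonpos (by linarith [b.rOut_pos])]
    linarith
  · intro x hx
    refine (intervalIntegral.integral_eq_integral_of_support_subset ?_).trans
      (b.integral_normed (μ := volume))
    rw [hρ, b.support_normed_eq, Real.ball_eq_Ioo]
    intro y hy
    exact ⟨by linarith [hy.1], by linarith [hy.2]⟩
  · intro x
    rw [← Real.norm_eq_abs]
    calc ‖∫ y in (-1)..x, ρ y‖ ≤ ∫ y in uIoc (-1) x, ‖ρ y‖ :=
          intervalIntegral.norm_integral_le_integral_norm_uIoc
      _ ≤ ∫ y, ‖ρ y‖ := setIntegral_le_integral b.integrable_normed.norm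
          (.of_forall fun _ => norm_nonneg _)
      _ = 1 := by
          simp_rw [hρ, Real.norm_of_nonneg (b.nonneg_normed _)]
          exact b.integral_normed

namespace NonautForm

/-- The fundamental theorem of calculus for weak derivatives. -/
theorem HasWeakTimeDeriv.sub_eq_integral {F : Type*} [NormedAddCommGroup F] [NormedSpace ℝ F]
    [CompleteSpace F] {T : ℝ} {g g' : ℝ → F} (h : HasWeakTimeDeriv T g g')
    (hg : ContinuousOn g (Ioo 0 T)) (hgi : IntegrableOn g (Ioo 0 T))
    (hg' : IntegrableOn g' (Ioo 0 T)) {s t : ℝ} (hs : 0 < s) (hst : s < t)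
    (ht : t < T) : g t - g s = ∫ x in s..t, g' x := by
  let b : ℕ → ContDiffBump (0 : ℝ) := fun n =>
    ⟨1 / ((n : ℝ) + 1) / 2, 1 / ((n : ℝ) + 1), by positivity, half_lt_self (by positivity)⟩
  have hb : Tendsto (fun n => (b n).rOut) atTop (𝓝 0) := tendsto_one_div_add_atTop_nhds_zero_nat
  have hb1 : ∀ n, (b n).rOut ≤ 1 := fun n => by
    simp only [b]
    rw [div_le_one (by positivity)]
    linarith [(Nat.cast_nonneg n : (0 : ℝ) ≤ n)]
  choose P hPc hPd hP0 hP1 hPb using fun n => (b n).exists_primitive (hb1 n)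
  -- A smoothed indicator of (s, t), whose derivative approximates δ_s - δ_t. Testing with it turns
  -- the weak identity into g(s) - g(t) = -∫ g' over (s, t) in the limit.
  let φ : ℕ → ℝ → ℝ := fun n x => P n (x - s) - P n (x - t)
  have hφd : ∀ n x, deriv (φ n) x = (b n).normed volume (x - s) - (b n).normed volume (x - t) :=
    fun n x => (((hPd n (x - s)).comp_sub_const x s).sub
      ((hPd n (x - t)).comp_sub_const x t)).deriv
  have hzero : ∀ n x, x ≤ s - (b n).rOut → φ n x = 0 := fun n x hx => by
    simp only [φ]
    rw [hP0 n _ (by linarith), hP0 n _ (by linarith), sub_zero]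
  have hzero' : ∀ n x, t + (b n).rOut ≤ x → φ n x = 0 := fun n x hx => by
    simp only [φ]
    rw [hP1 n _ (by linarith), hP1 n _ (by linarith), sub_self]
  have hone : ∀ n x, s + (b n).rOut ≤ x → x ≤ t - (b n).rOut → φ n x = 1 := fun n x hx hx' => by
    simp only [φ]
    rw [hP1 n _ (by linarith), hP0 n _ (by linarith), sub_zero]
  have hweak : ∀ᶠ n in atTop, ∫ x in Ioo 0 T, deriv (φ n) x • g x
      = -∫ x in Ioo 0 T, φ n x • g' x := by
    filter_upwards [hb.eventually_lt_const (sub_pos.2 ht), hb.eventually_lt_const hs] with n h1 h2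
    have hsupp : tsupport (φ n) ⊆ Icc (s - (b n).rOut) (t + (b n).rOut) := by
      refine closure_minimal (fun x hx => ?_) isClosed_Icc
      by_contra hx'
      rw [mem_Icc, not_and_or, not_le, not_le] at hx'
      rcases hx' with hx' | hx'
      · exact hx (hzero n x hx'.le)
      · exact hx (hzero' n x hx'.le)
    exact h ⟨φ n, ((hPc n).comp (contDiff_id.sub contDiff_const)).sub
        ((hPc n).comp (contDiff_id.sub contDiff_const)),
      HasCompactSupport.of_support_subset_isCompact isCompact_Icc (subset_closure.trans hsupp),
      hsupp.trans fun x hx => ⟨by linarith [hx.1], by linarith [hx.2]⟩⟩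
  have hR : Tendsto (fun n => -∫ x in Ioo 0 T, φ n x • g' x) atTop
      (𝓝 (-∫ x in Ioo 0 T, (Ioo s t).indicator g' x)) := by
    refine Tendsto.neg ?_
    refine tendsto_integral_of_dominated_convergence (fun x => 2 * ‖g' x‖) ?_ ?_ ?_ ?_
    · intro n
      have : Continuous (φ n) := by
        have := (hPc n).continuous
        fun_prop
      exact this.aestronglyMeasurable.smul hg'.1
    · exact hg'.norm.const_mul 2
    · refine fun n => .of_forall fun x => ?_
      rw [norm_smul]
      gcongr
      exact (abs_sub _ _).trans (by linarith [hPb n (x - s), hPb n (x - t)])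
    · have hne : ∀ᵐ x ∂(volume.restrict (Ioo 0 T)), x ≠ s ∧ x ≠ t :=
        ae_restrict_of_ae ((Measure.ae_ne volume s).and (Measure.ae_ne volume t))
      filter_upwards [hne] with x hx
      refine tendsto_const_nhds.congr' ?_
      rcases lt_or_gt_of_ne hx.1 with h1 | h1
      · filter_upwards [hb.eventually_lt_const (sub_pos.2 h1)] with n hn
        rw [hzero n x (by linarith), zero_smul,
          indicator_of_notMem (fun h' : x ∈ Ioo s t => absurd h'.1 h1.not_gt)]
      rcases lt_or_gt_of_ne hx.2 with h2 | h2
      · filter_upwards [hb.eventually_lt_const (sub_pos.2 h1),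
          hb.eventually_lt_const (sub_pos.2 h2)] with n hn hn'
        rw [hone n x (by linarith) (by linarith), one_smul, indicator_of_mem (show x ∈ Ioo s t from ⟨h1, h2⟩)]
      · filter_upwards [hb.eventually_lt_const (sub_pos.2 h2)] with n hn
        rw [hzero' n x (by linarith), zero_smul,
          indicator_of_notMem (fun h' : x ∈ Ioo s t => absurd h'.2 h2.not_gt)]
  have hloc : LocallyIntegrable ((Ioo 0 T).indicator g) volume :=
    ((integrable_indicator_iff measurableSet_Ioo).2 hgi).locallyIntegrable
  have hconv : ∀ r ∈ Ioo 0 T, Tendsto (fun n => ∫ x in Ioo 0 T, (b n).normed volume (x - r) • g x)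
      atTop (𝓝 (g r)) := by
    intro r hr
    have hcont : ContinuousAt ((Ioo 0 T).indicator g) r := by
      refine (hg.continuousAt (isOpen_Ioo.mem_nhds hr)).congr ?_
      filter_upwards [isOpen_Ioo.mem_nhds hr] with x hx
      rw [indicator_of_mem hx]
    have h1 := ContDiffBump.convolution_tendsto_right (μ := volume) hb
      (g := fun _ => (Ioo 0 T).indicator g) (z₀ := g r) (k := fun _ => r)
      (.of_forall fun _ => hloc.aestronglyMeasurable) (by
        have := hcont.tendsto.comp (tendsto_snd (f := (atTop : Filter ℕ)))
        rwa [indicator_of_mem hr] at this) tendsto_const_nhds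
    refine h1.congr fun n => ?_
    rw [convolution_eq_swap, ← integral_indicator measurableSet_Ioo]
    refine integral_congr_ae (.of_forall fun x => ?_)
    simp only [ContinuousLinearMap.lsmul_apply]
    -- The kernel is even, so ρ(x - r) is the convolution kernel ρ(r - x).
    rw [← ContDiffBump.normed_neg, neg_sub]
    by_cases hx : x ∈ Ioo 0 T <;> simp [hx]
  have hL : Tendsto (fun n => ∫ x in Ioo 0 T, deriv (φ n) x • g x) atTop (𝓝 (g s - g t)) := by
    refine ((hconv s ⟨hs, hst.trans ht⟩).sub (hconv t ⟨hs.trans hst, ht⟩)).congr fun n => ?_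
    have hint : ∀ r, IntegrableOn (fun x => (b n).normed volume (x - r) • g x) (Ioo 0 T) := by
      intro r
      have hc : Continuous fun x => (b n).normed volume (x - r) :=
        (b n).continuous_normed.comp (by fun_prop)
      obtain ⟨C, hC⟩ := (b n).continuous_normed.bounded_above_of_compact_support
        ((b n).hasCompactSupport_normed (μ := volume))
      exact hgi.bdd_smul C hc.aestronglyMeasurable (.of_forall fun x => hC _)
    rw [← integral_sub (hint s) (hint t)]
    refine integral_congr_ae (.of_forall fun x => ?_)
    simp only [hφd, sub_smul]
  have hlim := tendsto_nhds_unique (hL.congr' hweak) hR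
  rw [setIntegral_indicator measurableSet_Ioo,
    inter_eq_right.2 (Ioo_subset_Ioo hs.le ht.le)] at hlim
  rw [intervalIntegral.integral_of_le hst.le, integral_Ioc_eq_integral_Ioo, ← neg_sub, hlim,
    neg_neg]

/-- A continuous function whose backward increments are controlled by the oscillation of an
`L²` function is decreasing. -/
theorem le_of_increment_le {E : Type*} [NormedAddCommGroup E] {T : ℝ} {G : ℝ → ℝ}
    (hG : Continuous G) {U : ℝ → E} (hUm : StronglyMeasurable U) (hU : MemLp U 2 volume)
    {C : ℝ≥0∞} (hC : C ≠ ⊤)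
    (h : ∀ᵐ r ∂volume.restrict (Ioo 0 T), ∀ δ, 0 < δ → δ < r →
      ENNReal.ofReal (G r - G (r - δ))
        ≤ C * (‖U r‖ₑ * ∫⁻ y in Ioo 0 δ, ‖U (r - y) - U r‖ₑ))
    {s t : ℝ} (hs : 0 < s) (hst : s < t) (ht : t < T) : G t ≤ G s := by
  refine le_of_forall_pos_le_add fun ε hε => ?_
  set N := eLpNorm U 2 volume with hN
  have hNtop : N ≠ ⊤ := hU.eLpNorm_ne_top
  -- The tolerance ε is spent in thirds: one on the translation error, the others on the averages of
  -- G near t and near s.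
  obtain ⟨ε', hε', hle⟩ : ∃ ε' : ℝ≥0∞, 0 < ε' ∧ C * (N * ε') ≤ ENNReal.ofReal (ε / 3) := by
    have hCN : C * N ≠ ⊤ := ENNReal.mul_ne_top hC hNtop
    refine ⟨ENNReal.ofReal (ε / 3) / (C * N + 1),
      ENNReal.div_pos (by simpa using hε) (by simpa using hCN), ?_⟩
    rw [← mul_assoc, ← mul_div_assoc]
    refine ENNReal.div_le_of_le_mul ?_
    rw [mul_comm]
    gcongr
    exact le_self_add
  obtain ⟨δ₁, hδ₁, hball⟩ := Metric.eventually_nhds_iff.1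
    (ENNReal.tendsto_nhds_zero.1 hU.tendsto_eLpNorm_translate_sub ε' hε')
  obtain ⟨δ₂, hδ₂, hGt⟩ := Metric.continuous_iff.1 hG t (ε / 3) (by positivity)
  obtain ⟨δ₃, hδ₃, hGs⟩ := Metric.continuous_iff.1 hG s (ε / 3) (by positivity)
  -- Besides the three continuity moduli, δ < s is imposed, so that the increment bound applies at
  -- every r in (s, t).
  obtain ⟨δ, hδ, hδlt⟩ := exists_between (lt_min (lt_min hδ₁ hδ₂) (lt_min hδ₃ hs))
  simp only [lt_min_iff] at hδlt
  obtain ⟨⟨hd1, hd2⟩, hd3, hds⟩ := hδlt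
  have hint : ∀ a b, IntervalIntegrable G volume a b := fun a b => hG.intervalIntegrable a b
  have hGd : Continuous fun r => G r - G (r - δ) := by fun_prop
  have hupper : ∫ r in s..t, (G r - G (r - δ)) ≤ δ * (ε / 3) := by
    have key := lintegral_mul_lintegral_translate_sub_le (μ := volume) hUm
      (φ := fun x => ‖U x‖ₑ) (k := (Ioo 0 δ).indicator 1) hU.1.enorm
      (measurable_one.indicator measurableSet_Ioo).aemeasurable (ε := ε') (fun y hy => by
        refine hball ?_
        have hy' : y ∈ Ioo 0 δ := mem_of_indicator_ne_zero hy
        rw [dist_zero_right, Real.norm_eq_abs, abs_of_pos hy'.1]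
        exact hy'.2.trans hd1)
    have he : eLpNorm (fun x => ‖U x‖ₑ) 2 volume = N := eLpNorm_congr_enorm_ae (by simp)
    rw [lintegral_indicator_one measurableSet_Ioo, Real.volume_Ioo, sub_zero, he] at key
    have hstep : ENNReal.ofReal (∫ r in s..t, (G r - G (r - δ)))
        ≤ ENNReal.ofReal (δ * (ε / 3)) := by
      rw [intervalIntegral.integral_of_le hst.le, integral_Ioc_eq_integral_Ioo]
      have hi : IntegrableOn (fun r => G r - G (r - δ)) (Ioo s t) :=
        (hGd.integrableOn_Icc).mono_set Ioo_subset_Icc_self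
      calc ENNReal.ofReal (∫ r in Ioo s t, (G r - G (r - δ)))
          ≤ ENNReal.ofReal (∫ r in Ioo s t, max (G r - G (r - δ)) 0) :=
            ENNReal.ofReal_le_ofReal (integral_mono hi hi.pos_part fun r => le_max_left _ _)
        _ = ∫⁻ r in Ioo s t, ENNReal.ofReal (max (G r - G (r - δ)) 0) :=
            ofReal_integral_eq_lintegral_ofReal hi.pos_part
              (.of_forall fun r => le_max_right _ _)
        _ ≤ ∫⁻ r in Ioo s t, C * (‖U r‖ₑ * ∫⁻ y, (Ioo 0 δ).indicator 1 y *
              ‖U (r - y) - U r‖ₑ) := by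
            refine lintegral_mono_ae ?_
            filter_upwards [ae_restrict_of_ae_restrict_of_subset
              (Ioo_subset_Ioo hs.le ht.le) h, ae_restrict_mem measurableSet_Ioo] with r hr hr'
            rw [ENNReal.ofReal_max, ENNReal.ofReal_zero, max_eq_left (zero_le)]
            refine (hr δ hδ (hds.trans hr'.1)).trans_eq ?_
            rw [← lintegral_indicator measurableSet_Ioo]
            congr 3
            ext y
            by_cases hy : y ∈ Ioo 0 δ <;> simp [hy]
        _ ≤ ∫⁻ r, C * (‖U r‖ₑ * ∫⁻ y, (Ioo 0 δ).indicator 1 y * ‖U (r - y) - U r‖ₑ) :=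
            setLIntegral_le_lintegral _ _
        _ ≤ C * (ENNReal.ofReal δ * (N * ε')) := by
            rw [lintegral_const_mul' _ _ hC]
            gcongr
        _ = ENNReal.ofReal δ * (C * (N * ε')) := by ring
        _ ≤ ENNReal.ofReal δ * ENNReal.ofReal (ε / 3) := by gcongr
        _ = ENNReal.ofReal (δ * (ε / 3)) := (ENNReal.ofReal_mul hδ.le).symm
    exact (ENNReal.ofReal_le_ofReal_iff (by positivity)).1 hstep
  -- The integral of the increments telescopes to the difference of two integrals over intervals of
  -- length δ ending at t and at s.
  have hshift : ∫ r in s..t, (G r - G (r - δ))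
      = (∫ r in (t - δ)..t, G r) - ∫ r in (s - δ)..s, G r := by
    rw [intervalIntegral.integral_sub (hint _ _)
      (Continuous.intervalIntegrable (u := fun r => G (r - δ)) (by fun_prop) _ _),
      intervalIntegral.integral_comp_sub_right]
    have h1 := intervalIntegral.integral_add_adjacent_intervals (hint (s - δ) s) (hint s t)
    have h2 := intervalIntegral.integral_add_adjacent_intervals (hint (s - δ) (t - δ))
      (hint (t - δ) t)
    linarith
  have hlow : δ * (G t - ε / 3) ≤ ∫ r in (t - δ)..t, G r := by
    have := intervalIntegral.integral_mono_on (a := t - δ) (b := t) (by linarith)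
      (intervalIntegrable_const (c := G t - ε / 3)) (hint _ _) (fun r hr => by
        have := hGt r (by rw [Real.dist_eq, abs_lt]; constructor <;> linarith [hr.1, hr.2])
        rw [Real.dist_eq, abs_lt] at this
        linarith)
    rw [intervalIntegral.integral_const, sub_sub_cancel] at this
    exact this
  have hup : ∫ r in (s - δ)..s, G r ≤ δ * (G s + ε / 3) := by
    have := intervalIntegral.integral_mono_on (a := s - δ) (b := s) (by linarith) (hint _ _)
      (intervalIntegrable_const (c := G s + ε / 3)) (fun r hr => by
        have := hGs r (by rw [Real.dist_eq, abs_lt]; constructor <;> linarith [hr.1, hr.2])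
        rw [Real.dist_eq, abs_lt] at this
        linarith)
    rw [intervalIntegral.integral_const, sub_sub_cancel] at this
    exact this
  rw [hshift] at hupper
  have : δ * (G t) ≤ δ * (G s + ε) := by nlinarith
  exact le_of_mul_le_mul_left this hδ

end NonautForm

/-! ### Truncation in L² and the comparison principle -/

namespace NonautForm

variable {d : ℕ} {Ω : Opens (EuclideanSpace ℝ (Fin d))}

theorem lipschitzWith_posPart_sub (c : ℝ) : LipschitzWith 1 fun s : ℝ => max (s - c) 0 :=
  ((LipschitzWith.of_dist_le_mul fun x y => by simp [Real.dist_eq]) :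
    LipschitzWith 1 fun s : ℝ => s - c).max_const 0

/-- The function `(w - c)⁺ ∈ L²(Ω)`, for `c ≥ 0`. -/
noncomputable def posPartSub {c : ℝ} (hc : 0 ≤ c) (w : L2 Ω) : L2 Ω :=
  (lipschitzWith_posPart_sub c).compLp (by simpa using hc) w

theorem coeFn_posPartSub {c : ℝ} (hc : 0 ≤ c) (w : L2 Ω) :
    ∀ᵐ x ∂volume.restrict (Ω : Set (EuclideanSpace ℝ (Fin d))),
      posPartSub hc w x = max (w x - c) 0 :=
  (lipschitzWith_posPart_sub c).coeFn_compLp _ w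

theorem continuous_posPartSub {c : ℝ} (hc : 0 ≤ c) :
    Continuous (posPartSub hc : L2 Ω → L2 Ω) :=
  (lipschitzWith_posPart_sub c).continuous_compLp (by simpa using hc)

theorem posPartSub_eq_zero_iff {c : ℝ} (hc : 0 ≤ c) (w : L2 Ω) :
    posPartSub hc w = 0 ↔
      ∀ᵐ x ∂volume.restrict (Ω : Set (EuclideanSpace ℝ (Fin d))), w x ≤ c := by
  rw [Lp.eq_zero_iff_ae_eq_zero]
  constructor
  · intro h
    filter_upwards [h, coeFn_posPartSub hc w] with x h1 h2
    rw [h1, Pi.zero_apply] at h2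
    linarith [le_max_left (w x - c) 0]
  · intro h
    filter_upwards [h, coeFn_posPartSub hc w] with x h1 h2
    rw [h2, max_eq_right (by linarith), Pi.zero_apply]

/-- The subgradient inequality for the convex function `w ↦ ‖(w - c)⁺‖² / 2`. -/
theorem norm_sq_posPartSub_sub_le {c : ℝ} (hc : 0 ≤ c) (w z : L2 Ω) :
    ‖posPartSub hc w‖ ^ 2 / 2 - ‖posPartSub hc z‖ ^ 2 / 2
      ≤ inner ℝ (posPartSub hc w) (w - z) := by
  -- Here w - (w - c)⁺ = min(w, c), and where (w - c)⁺ > 0 this equals c ≥ min(z, c). Hence the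
  -- inner product with w - z dominates the one with (w - c)⁺ - (z - c)⁺, and completing the square
  -- finishes.
  have h1 : 0 ≤ inner ℝ (posPartSub hc w) ((w - posPartSub hc w) - (z - posPartSub hc z)) := by
    rw [L2.inner_def]
    refine integral_nonneg_of_ae ?_
    filter_upwards [coeFn_posPartSub hc w, coeFn_posPartSub hc z,
      Lp.coeFn_sub (w - posPartSub hc w) (z - posPartSub hc z), Lp.coeFn_sub w (posPartSub hc w),
      Lp.coeFn_sub z (posPartSub hc z)] with x hw hz h1 h2 h3
    rw [h1, Pi.sub_apply, h2, h3, Pi.sub_apply, Pi.sub_apply, hw, hz, Pi.zero_apply]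
    simp only [RCLike.inner_apply, conj_trivial]
    rcases le_total (w x - c) 0 with h | h
    · simp [max_eq_right h]
    · rw [max_eq_left h]
      refine mul_nonneg ?_ h
      linarith [le_max_left (z x - c) 0]
  have h2 : (w - posPartSub hc w) - (z - posPartSub hc z)
      = (w - z) - (posPartSub hc w - posPartSub hc z) := by abel
  rw [h2, inner_sub_right, inner_sub_right (posPartSub hc w) (posPartSub hc w),
    real_inner_self_eq_norm_sq] at h1
  have h3 := norm_sub_sq_real (posPartSub hc w) (posPartSub hc z)
  nlinarith [sq_nonneg ‖posPartSub hc w - posPartSub hc z‖]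

variable {V : Submodule ℝ (H1 Ω)}

/-- The embedding `L²(Ω) → V'`, `w ↦ (w | ·)_{L²}`. -/
noncomputable def dualEmb (V : Submodule ℝ (H1 Ω)) : L2 Ω →L[ℝ] NDual V :=
  ((ContinuousLinearMap.compL ℝ V (L2 Ω) ℝ).flip (emb V)).comp (innerSL ℝ)

theorem dualEmb_apply (w : L2 Ω) (v : V) : dualEmb V w v = inner ℝ w (emb V v) := rfl

theorem dualEmb_emb (v : V) : dualEmb V (emb V v) = embDual V v := rfl

/-- The exceptional set of times depends on v. A dense sequence in the cone of nonnegative elements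
and the continuity of f(t) give a single null set for all v. -/
theorem DualNonneg.ae_forall {T : ℝ} {f : ℝ → NDual V} (h : DualNonneg T V f) :
    ∀ᵐ t ∂volume.restrict (Ioo 0 T), ∀ v : V,
      (∀ᵐ x ∂volume.restrict (Ω : Set (EuclideanSpace ℝ (Fin d))), 0 ≤ emb V v x) →
      0 ≤ f t v := by
  let S := {v : V // ∀ᵐ x ∂volume.restrict (Ω : Set (EuclideanSpace ℝ (Fin d))), 0 ≤ emb V v x}
  have hV : SecondCountableTopology V :=
    IsInducing.secondCountableTopology (f := fun v : V => (v : H1 Ω)) .subtypeVal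
  have hS : SecondCountableTopology S :=
    IsInducing.secondCountableTopology (f := fun v : S => (v : V)) .subtypeVal
  have : Nonempty S := ⟨0, by
    rw [map_zero]
    filter_upwards [Lp.coeFn_zero ℝ 2
      (volume.restrict (Ω : Set (EuclideanSpace ℝ (Fin d))))] with x hx
    rw [hx]; rfl⟩
  obtain ⟨e, he⟩ := TopologicalSpace.exists_dense_seq S
  filter_upwards [ae_all_iff.2 fun n => h (e n).1 (e n).2] with t ht v hv
  exact he.induction_on (p := fun v : S => 0 ≤ f t v.1) ⟨v, hv⟩
    (isClosed_le continuous_const ((f t).continuous.comp continuous_subtype_val)) ht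

variable {a : Fin d → Fin d → ℝ → EuclideanSpace ℝ (Fin d) → ℝ}

/-- The comparison principle `u₀ ≤ c ⟹ u(t) ≤ c`, if `V` is stable under `v ↦ (v - c)⁺`. -/
theorem IsSolution.le_const {T : ℝ} (hT : 0 < T) (ha : IsEllipticCoeff T Ω a)
    {f : ℝ → NDual V} {u₀ : L2 Ω} {w : ℝ → L2 Ω}
    (hu : IsSolution T V a f u₀ w) {c : ℝ} (hc : 0 ≤ c)
    (hV : ∀ v : V, ∃ p : V, emb V p = posPartSub hc (emb V v))
    (hf : DualNonneg T V (-f))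
    (h0 : ∀ᵐ x ∂volume.restrict (Ω : Set (EuclideanSpace ℝ (Fin d))), u₀ x ≤ c) :
    ∀ t ∈ Icc 0 T, ∀ᵐ x ∂volume.restrict (Ω : Set (EuclideanSpace ℝ (Fin d))), w t x ≤ c := by
  obtain ⟨u, u', hMR, hw, hwu, heq, hw0⟩ := hu
  obtain ⟨M₀, hM₀⟩ := ha.bounded
  set M := max M₀ 0 with hM
  have hMb : ∀ t ∈ Ioo 0 T, ∀ k j, ∀ x ∈ Ω, |a k j t x| ≤ M := fun t ht k j x hx =>
    (hM₀ k j t (Ioo_subset_Icc_self ht) x hx).trans (le_max_left _ _)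
  choose P hP using hV
  have hPae : ∀ v, ∀ᵐ x ∂volume.restrict (Ω : Set (EuclideanSpace ℝ (Fin d))),
      toL2 (P v : H1 Ω) x = max (toL2 (v : H1 Ω) x - c) 0 := fun v => by
    have := coeFn_posPartSub hc (emb V v)
    rw [← hP] at this
    exact this
  have hPnorm : ∀ v, ‖P v‖ ≤ ‖v‖ := fun v => norm_le_of_posPart hc (hPae v)
  have hPnonneg : ∀ v, ∀ᵐ x ∂volume.restrict (Ω : Set (EuclideanSpace ℝ (Fin d))),
      0 ≤ emb V (P v) x := fun v => by
    filter_upwards [hPae v] with x hx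
    exact (le_max_right _ _).trans_eq hx.symm
  set C : ℝ := d * d * M with hC
  have hC0 : 0 ≤ C := by positivity
  -- a globally defined strongly measurable version of `u`
  set U : ℝ → V := (Ioo 0 T).indicator (hMR.memLp.1.mk u) with hU
  have hUm : StronglyMeasurable U :=
    hMR.memLp.1.stronglyMeasurable_mk.indicator measurableSet_Ioo
  have hUL : MemLp U 2 volume :=
    (memLp_indicator_iff_restrict measurableSet_Ioo).2 (hMR.memLp.ae_eq hMR.memLp.1.ae_eq_mk)
  have hUu : ∀ᵐ t ∂volume.restrict (Ioo 0 T), u t = U t := by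
    filter_upwards [hMR.memLp.1.ae_eq_mk, ae_restrict_mem measurableSet_Ioo] with t ht ht'
    rw [hU, indicator_of_mem ht', ht]
  -- For frozen v, split u(σ) = v + (u(σ) - v) in the first slot of the form: 𝔞(σ, v, Pv) ≥ 0 and
  -- ⟨f(σ), Pv⟩ ≤ 0 drop out, and boundedness with ‖Pv‖ ≤ ‖v‖ controls the rest.
  have hpair : ∀ v : V, ∀ᵐ σ ∂volume.restrict (Ioo 0 T),
      u' σ (P v) ≤ C * (‖U σ - v‖ * ‖v‖) := by
    intro v
    filter_upwards [heq, hUu, ha.ae_slice, hf.ae_forall, ae_restrict_mem measurableSet_Ioo]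
      with σ h1 h2 h3 h4 hσ
    have h5 := h1 (P v)
    have h6 := h4 (P v) (hPnonneg v)
    rw [Pi.neg_apply, neg_apply] at h6
    have h7 := form_nonneg_of_posPart (hMb σ hσ) h3.1 h3.2 (hPae v)
    have h8 := form_sub_left (hMb σ hσ) h3.1 (u σ : H1 Ω) (v : H1 Ω) (P v : H1 Ω)
    have h9 := abs_form_le (le_max_right M₀ 0) (hMb σ hσ) ((u σ : H1 Ω) - (v : H1 Ω))
      (P v : H1 Ω)
    have h10 : C * ‖(u σ : H1 Ω) - (v : H1 Ω)‖ * ‖(P v : H1 Ω)‖ ≤ C * (‖U σ - v‖ * ‖v‖) := by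
      rw [← h2, mul_assoc]
      gcongr
      · exact le_rfl
      · exact hPnorm v
    linarith [(abs_le.1 h9).1]
  have hu'i : IntegrableOn u' (Ioo 0 T) := hMR.memLp_deriv.integrable (by norm_num)
  -- The weak identity is moved to the continuous representative, whose values at individual times
  -- are meaningful.
  have hweak : HasWeakTimeDeriv T (fun t => dualEmb V (w t)) u' := by
    intro φ
    rw [← hMR.hasWeakTimeDeriv φ]
    refine integral_congr_ae ?_
    filter_upwards [hwu] with t ht
    simp only [ht, dualEmb_emb]
  have hwc : ContinuousOn (fun t => dualEmb V (w t)) (Icc 0 T) :=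
    (dualEmb V).continuous.comp_continuousOn hw
  have hftc : ∀ {s t : ℝ}, 0 < s → s < t → t < T →
      dualEmb V (w t) - dualEmb V (w s) = ∫ σ in s..t, u' σ :=
    fun hs hst ht => hweak.sub_eq_integral (hwc.mono Ioo_subset_Icc_self)
      ((hwc.integrableOn_Icc).mono_set Ioo_subset_Icc_self) hu'i hs hst ht
  -- the energy, extended to a continuous function on the real line
  let G₀ : ℝ → ℝ := fun t => ‖posPartSub hc (w t)‖ ^ 2 / 2
  have hG₀ : ContinuousOn G₀ (Icc 0 T) :=
    (((continuous_posPartSub hc).comp_continuousOn hw).norm.pow 2).div_const 2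
  let G : ℝ → ℝ := IccExtend hT.le ((Icc 0 T).domRestrict G₀)
  have hG : Continuous G := hG₀.domRestrict.Icc_extend'
  have hGG : ∀ t ∈ Icc 0 T, G t = G₀ t := fun t ht => IccExtend_of_mem _ _ ht
  -- Subgradient inequality at w(r), then the fundamental theorem tested against the fixed vector
  -- P(U r), then `hpair` with v = U r; the substitution σ = r - y gives the form required by
  -- `le_of_increment_le`.
  have hincr : ∀ᵐ r ∂volume.restrict (Ioo 0 T), ∀ δ, 0 < δ → δ < r →
      ENNReal.ofReal (G r - G (r - δ))
        ≤ ENNReal.ofReal C * (‖U r‖ₑ * ∫⁻ y in Ioo 0 δ, ‖U (r - y) - U r‖ₑ) := by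
    filter_upwards [hwu, hUu, ae_restrict_mem measurableSet_Ioo] with r hr hr' hrT δ hδ hδr
    have hsub : Ioo (r - δ) r ⊆ Ioo 0 T := Ioo_subset_Ioo (by linarith) hrT.2.le
    have hUi : IntegrableOn (fun σ => ‖U σ - U r‖) (Ioo (r - δ) r) :=
      (((hUL.restrict _).integrable (by norm_num)).sub (integrable_const _)).norm
    have h1 : G r - G (r - δ) ≤ ∫ σ in Ioo (r - δ) r, C * (‖U σ - U r‖ * ‖U r‖) := by
      rw [hGG r (Ioo_subset_Icc_self hrT), hGG (r - δ) ⟨by linarith, by linarith [hrT.2]⟩]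
      calc G₀ r - G₀ (r - δ)
          ≤ inner ℝ (posPartSub hc (w r)) (w r - w (r - δ)) := norm_sq_posPartSub_sub_le hc _ _
        _ = (dualEmb V (w r) - dualEmb V (w (r - δ))) (P (U r)) := by
            rw [← map_sub, dualEmb_apply, hP, real_inner_comm, hr, hr']
        _ = ∫ σ in Ioo (r - δ) r, u' σ (P (U r)) := by
            rw [hftc (by linarith) (by linarith) hrT.2,
              intervalIntegral.integral_of_le (by linarith), integral_Ioc_eq_integral_Ioo,
              ContinuousLinearMap.integral_apply (hu'i.mono_set hsub)]
        _ ≤ _ := by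
            refine integral_mono_ae ((hu'i.mono_set hsub).apply_continuousLinearMap _)
              ((hUi.mul_const _).const_mul C) ?_
            exact ae_restrict_of_ae_restrict_of_subset hsub (hpair (U r))
    rw [integral_const_mul, integral_mul_const] at h1
    refine (ENNReal.ofReal_le_ofReal h1).trans_eq ?_
    rw [ENNReal.ofReal_mul hC0, mul_comm (∫ σ in Ioo (r - δ) r, ‖U σ - U r‖),
      ENNReal.ofReal_mul (norm_nonneg _), ofReal_norm,
      ofReal_integral_eq_lintegral_ofReal hUi (.of_forall fun _ => norm_nonneg _)]
    simp_rw [ofReal_norm]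
    congr 2
    have hmp : MeasurePreserving (fun y : ℝ => r - y) volume volume :=
      Measure.measurePreserving_sub_left volume r
    rw [← hmp.setLIntegral_comp_preimage measurableSet_Ioo (f := fun σ => ‖U σ - U r‖ₑ)
      (hUm.sub stronglyMeasurable_const).enorm]
    congr 2
    ext y
    simp only [mem_preimage, mem_Ioo]
    constructor <;> rintro ⟨h1, h2⟩ <;> constructor <;> linarith
  have hdec : ∀ {s t : ℝ}, 0 < s → s < t → t < T → G t ≤ G s := fun hs hst ht =>
    le_of_increment_le hG hUm hUL (by simp) hincr hs hst ht
  have hG0 : G 0 = 0 := by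
    rw [hGG 0 ⟨le_rfl, hT.le⟩]
    simp only [G₀, hw0, (posPartSub_eq_zero_iff hc u₀).2 h0]
    simp
  -- Monotonicity is known only at interior times; letting s ↓ 0 gives G(t) ≤ G(0) = 0 there, and
  -- continuity extends this to the endpoints.
  have hle : Icc 0 T ⊆ {t | G t ≤ 0} := by
    rw [← closure_Ioo hT.ne]
    refine closure_minimal (fun t ht => ?_) (isClosed_le hG continuous_const)
    rw [mem_ofPred_eq, ← hG0]
    refine ge_of_tendsto (hG.continuousWithinAt (s := Ioi 0)).tendsto ?_
    filter_upwards [Ioo_mem_nhdsGT ht.1] with s hs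
    exact hdec hs.1 hs.2 ht.2
  intro t ht
  rw [← posPartSub_eq_zero_iff hc, ← norm_eq_zero]
  have h1 : G t ≤ 0 := hle ht
  rw [hGG t ht] at h1
  have h2 : ‖posPartSub hc (w t)‖ ^ 2 ≤ 0 := by
    simp only [G₀] at h1
    linarith
  exact pow_eq_zero_iff two_ne_zero |>.1 (le_antisymm h2 (sq_nonneg _))

theorem form_neg_left (t : ℝ) (u v : H1 Ω) : form a t (-u) v = -form a t u v := by
  simp only [form, ← Finset.sum_neg_distrib]
  refine Finset.sum_congr rfl fun k _ => Finset.sum_congr rfl fun j _ => ?_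
  rw [← integral_neg]
  refine integral_congr_ae ?_
  filter_upwards [Lp.coeFn_neg (partialD k u)] with x hx
  have : partialD k (-u) x = -partialD k u x := hx
  rw [this]
  ring

/-- Linearity of the problem turns lower bounds into upper bounds, so positivity becomes the case c
= 0 for -u. -/
theorem IsSolution.neg {T : ℝ} {f : ℝ → NDual V} {u₀ : L2 Ω} {w : ℝ → L2 Ω}
    (hu : IsSolution T V a f u₀ w) : IsSolution T V a (-f) (-u₀) (-w) := by
  obtain ⟨u, u', hMR, hw, hwu, heq, hw0⟩ := hu
  refine ⟨-u, -u', ⟨hMR.memLp.neg, hMR.memLp_deriv.neg, fun φ => ?_⟩, hw.neg, ?_, ?_, ?_⟩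
  · have h1 : ∀ t, embDual V ((-u) t) = -embDual V (u t) := fun t => by
      rw [← dualEmb_emb, ← dualEmb_emb, Pi.neg_apply, map_neg, map_neg]
    simp only [h1]
    simp only [Pi.neg_apply, smul_neg, integral_neg]
    rw [hMR.hasWeakTimeDeriv φ]
  · filter_upwards [hwu] with t ht
    rw [Pi.neg_apply, Pi.neg_apply, map_neg, ht]
  · filter_upwards [heq] with t ht v
    have h1 : form a t ((-u) t : H1 Ω) (v : H1 Ω) = -form a t (u t : H1 Ω) (v : H1 Ω) :=
      form_neg_left t _ _
    rw [h1, Pi.neg_apply, Pi.neg_apply, neg_apply,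
      neg_apply, ← ht v, neg_add]
  · rw [Pi.neg_apply, hw0]

end NonautForm

theorem mainTheorem6 {d : ℕ} (Ω : Opens (EuclideanSpace ℝ (Fin d))) (T : ℝ) (hT : 0 < T)
    (V : Submodule ℝ (NonautForm.H1 Ω)) (hVclosed : IsClosed (V : Set (NonautForm.H1 Ω)))
    (hV : NonautForm.H10 Ω ≤ V)
    (a : Fin d → Fin d → ℝ → EuclideanSpace ℝ (Fin d) → ℝ)
    (ha : NonautForm.IsEllipticCoeff T Ω a)
    (f : ℝ → NonautForm.NDual V) (hf : MemLp f 2 (volume.restrict (Ioo 0 T)))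
    (u₀ : NonautForm.L2 Ω) (u : ℝ → NonautForm.L2 Ω)
    (hu : NonautForm.IsSolution T V a f u₀ u) :
    (NonautForm.DualNonneg T V f → NonautForm.StablePosPart V →
      (∀ᵐ x ∂volume.restrict (Ω : Set (EuclideanSpace ℝ (Fin d))), 0 ≤ u₀ x) →
      ∀ t ∈ Icc 0 T,
        ∀ᵐ x ∂volume.restrict (Ω : Set (EuclideanSpace ℝ (Fin d))), 0 ≤ u t x) ∧
    (NonautForm.DualNonneg T V (-f) → NonautForm.StableMinOne V →
      (∀ᵐ x ∂volume.restrict (Ω : Set (EuclideanSpace ℝ (Fin d))), u₀ x ≤ 1) →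
      ∀ t ∈ Icc 0 T,
        ∀ᵐ x ∂volume.restrict (Ω : Set (EuclideanSpace ℝ (Fin d))), u t x ≤ 1) := by
  constructor
  · intro hpos hstab h0 t ht
    -- With c = 0 the truncation (v - c)⁺ is v⁺, so the stability hypothesis is exactly the one
    -- needed.
    have key := hu.neg.le_const hT ha (c := 0) le_rfl (fun v => by
      obtain ⟨p, hp⟩ := hstab v
      refine ⟨p, Lp.ext ?_⟩
      filter_upwards [hp, NonautForm.coeFn_posPartSub le_rfl (NonautForm.emb V v)] with x h1 h2
      rw [h1, h2, sub_zero]) (by rwa [neg_neg]) (by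
      filter_upwards [h0, Lp.coeFn_neg u₀] with x h1 h2
      rw [h2, Pi.neg_apply]
      linarith) t ht
    filter_upwards [key, Lp.coeFn_neg (u t)] with x h1 h2
    rw [Pi.neg_apply, h2, Pi.neg_apply] at h1
    linarith
  · intro hneg hstab h0
    refine hu.le_const hT ha zero_le_one (fun v => ?_) hneg h0
    obtain ⟨p, hp⟩ := hstab v
    -- The witness comes from (v - 1)⁺ = v - min(v, 1).
    refine ⟨v - p, Lp.ext ?_⟩
    rw [map_sub]
    filter_upwards [hp, NonautForm.coeFn_posPartSub zero_le_one (NonautForm.emb V v),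
      Lp.coeFn_sub (NonautForm.emb V v) (NonautForm.emb V p)] with x h1 h2 h3
    rw [h3, Pi.sub_apply, h1, h2]
    rcases le_total (NonautForm.emb V v x) 1 with h | h
    · rw [min_eq_left h, max_eq_right (by linarith), sub_self]
    · rw [min_eq_right h, max_eq_left (by linarith)]
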